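/- Let $a,c\in\mathbb Z$ and let $k,m,n\geq 1$ be integers with $km>n$. Let $K=\mathbb Q(\theta)$ be a number field with $\theta$ in its ring of integers $\mathbb Z_K$, such that the minimal polynomial of $\theta$ over $\mathbb Q$ is $f(x)=(x^k+c)^m-ax^n$. Let $\mathfrak D_f$ be the discriminant of $f$, put $t=\gcd(n,k)$, $n_1=n/t$, $k_1=k/t$, and $$\mathcal C=(km)^{k_1m}c^{k_1m-n_1},\qquad \mathcal E=a^{k_1}n^{n_1}(km-n)^{k_1m-n_1}.$$ A prime divisor $p$ of $\mathfrak D_f$ does not divide the index $[\mathbb Z_K:\mathbb Z[\theta]]$ if and only if $p$ satisfies one of the following conditions: (i) $p\mid c$, $p\mid a$, $m=1$ and $p^2\nmid c$. (ii) $p\mid c$, $p\nmid a$, $n=1$, and, with $p^j$ ($j\geq1$) the highest power of $p$ dividing $km-1$, $c_2=\frac cp$ and $a_1=\frac{a^{p^j}-a}p$, either $p\mid c_2$ and $p\nmid a_1$, or $p\nmid c_2\left[a^ka_1^{km-1}-(-mac_2)^{km-1}\right]$. (iii) $p\mid c$, $p\nmid a$, $n\geq2$, $m=1$, and, with $p^\ell$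 ($\ell\geq0$) the highest power of $p$ dividing $k-n$, $c_2=\frac cp$ and $a_1=\frac{a^{p^\ell}-a}p$, either $p\mid a_1$ and $p\nmid c_2$, or $p\nmid a_1c_2^{n-1}\left[a^{n_1}a_1^{k_1-n_1}-(-c_2)^{k_1-n_1}\right]$. (iv) $p\nmid c$, $p\mid a$, and one of the following holds: (a) $m\geq2$ and $p^2\nmid a$; (b) $m=1$ and, with $p^\ell$ ($\ell\geq1$) the highest power of $p$ dividing $k$, $a_2=-\frac ap$ and $c_1=\frac{(-c)^{p^\ell}+c}p$, either $p\mid a_2$ and $p\nmid c_1$, or $p\nmid a_2\left[a_2^{k_1}(-c)^{n_1}-(-c_1)^{k_1}\right]$. (v) $p\nmid ca$, $p\mid k$, and, writing $k=p^js'$ and $n=p^js$ with $p\nmid\gcd(s,s')$, the polynomials $$\frac1p\left[(a^{p^j}-a)x^n-pm\,t(x)(x^k+c)^{m-1}\right]\quad\text{and}\quad(x^{s'}+c)^m-ax^s$$ are coprime modulo $p$, where $t(x)=\frac1p\left(\sum_{i=0}^{p^j-1}\binom{p^j}{i}x^{s'i}c^{p^j-i}-c\right)\in\mathbb Z[x]$.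 (vi) $p\nmid cak$, $p\mid m$, $p\mid n$ and $p^2\nmid(a^p-a)$. (vii) $p\nmid cakm$ and $p^2\nmid(\mathcal C-\mathcal E)$. Consequently, $\mathbb Z_K=\mathbb Z[\theta]$ if and only if every prime $p$ dividing $\mathfrak D_f$ satisfies one of the conditions (i)–(vii). -/

import Mathlib

open Polynomial

namespace PolyFamily

/-- The polynomial `(x ^ k + c) ^ m - a x ^ n` with integer coefficients. -/
noncomputable def poly (a c : ℤ) (k m n : ℕ) : ℤ[X] :=
  (X ^ k + C c) ^ m - C a * X ^ n

/-- Coefficientwise (integer) division by `d`. It is applied only to polynomials all of whose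
coefficients are divisible by `d`, where it gives the polynomial `(1 / d) P`. -/
noncomputable def divInt (d : ℤ) (P : ℤ[X]) : ℤ[X] :=
  P.sum fun i b => monomial i (b / d)

theorem coeff_divInt (d : ℤ) (P : ℤ[X]) (i : ℕ) : (divInt d P).coeff i = P.coeff i / d := by
  simp only [divInt, Polynomial.sum, finsetSum_coeff, coeff_monomial]
  rw [Finset.sum_ite_eq' P.support i]
  split_ifs with h
  · rfl
  · rw [notMem_support_iff.mp h, Int.zero_ediv]

theorem C_mul_divInt {d : ℤ} {P : ℤ[X]} (h : C d ∣ P) : C d * divInt d P = P := by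
  ext i
  rw [coeff_C_mul, coeff_divInt]
  exact Int.mul_ediv_cancel' ((C_dvd_iff_dvd_coeff d P).mp h i)

/-- Two integer polynomials are coprime modulo `p`. -/
def CoprimeMod (p : ℕ) (P Q : ℤ[X]) : Prop :=
  IsCoprime (P.map (Int.castRingHom (ZMod p))) (Q.map (Int.castRingHom (ZMod p)))

/-- `k₁ = k / gcd (n, k)`. -/
def kOne (k n : ℕ) : ℕ := k / Nat.gcd n k

/-- `n₁ = n / gcd (n, k)`. -/
def nOne (k n : ℕ) : ℕ := n / Nat.gcd n k

/-- `𝒞 = (k m) ^ (k₁ m) c ^ (k₁ m - n₁)`. -/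
def calC (c : ℤ) (k m n : ℕ) : ℤ :=
  ((k : ℤ) * m) ^ (kOne k n * m) * c ^ (kOne k n * m - nOne k n)

/-- `ℰ = a ^ k₁ n ^ n₁ (k m - n) ^ (k₁ m - n₁)`. -/
def calE (a : ℤ) (k m n : ℕ) : ℤ :=
  a ^ kOne k n * (n : ℤ) ^ nOne k n * ((k : ℤ) * m - n) ^ (kOne k n * m - nOne k n)

/-- The integer `(b ^ (p ^ j) - b) / p`; the division is exact for `p` prime. -/
def frobQuot (p : ℕ) (b : ℤ) (j : ℕ) : ℤ := (b ^ p ^ j - b) / p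

/-- The case `p ∣ c`, `p ∣ a`. -/
def CondI (a c : ℤ) (m p : ℕ) : Prop :=
  (p : ℤ) ∣ c ∧ (p : ℤ) ∣ a ∧ m = 1 ∧ ¬ (p : ℤ) ^ 2 ∣ c

/-- The case `p ∣ c`, `p ∤ a`, `n = 1`; here `p ^ j` exactly divides `k m - 1`. -/
def CondII (a c : ℤ) (k m n p : ℕ) : Prop :=
  (p : ℤ) ∣ c ∧ ¬ (p : ℤ) ∣ a ∧ n = 1 ∧
    let j : ℕ := padicValNat p (k * m - 1)
    let c₂ : ℤ := c / p
    let a₁ : ℤ := frobQuot p a j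
    1 ≤ j ∧
      (((p : ℤ) ∣ c₂ ∧ ¬ (p : ℤ) ∣ a₁) ∨
        ¬ (p : ℤ) ∣ c₂ * (a ^ k * a₁ ^ (k * m - 1) - (-(m * a * c₂)) ^ (k * m - 1)))

/-- The case `p ∣ c`, `p ∤ a`, `n ≥ 2`; here `m = 1`, so that `k > n`, and `p ^ l` exactly
divides `k - n` (with `l = 0` allowed). -/
def CondIII (a c : ℤ) (k m n p : ℕ) : Prop :=
  (p : ℤ) ∣ c ∧ ¬ (p : ℤ) ∣ a ∧ 2 ≤ n ∧ m = 1 ∧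
    let l : ℕ := padicValNat p (k - n)
    let c₂ : ℤ := c / p
    let a₁ : ℤ := frobQuot p a l
    ((p : ℤ) ∣ a₁ ∧ ¬ (p : ℤ) ∣ c₂) ∨
      ¬ (p : ℤ) ∣ a₁ * c₂ ^ (n - 1) *
        (a ^ nOne k n * a₁ ^ (kOne k n - nOne k n) - (-c₂) ^ (kOne k n - nOne k n))

/-- The case `p ∤ c`, `p ∣ a`; for `m = 1`, `p ^ l` exactly divides `k`, and
`c₁ = ((-c) ^ (p ^ l) + c) / p`, `a₂ = - a / p`. -/
def CondIV (a c : ℤ) (k m n p : ℕ) : Prop :=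
  ¬ (p : ℤ) ∣ c ∧ (p : ℤ) ∣ a ∧
    ((2 ≤ m ∧ ¬ (p : ℤ) ^ 2 ∣ a) ∨
      (m = 1 ∧
        let l : ℕ := padicValNat p k
        let a₂ : ℤ := -(a / p)
        let c₁ : ℤ := frobQuot p (-c) l
        1 ≤ l ∧
          (((p : ℤ) ∣ a₂ ∧ ¬ (p : ℤ) ∣ c₁) ∨
            ¬ (p : ℤ) ∣ a₂ * (a₂ ^ kOne k n * (-c) ^ nOne k n - (-c₁) ^ kOne k n))))

/-- The polynomial `t(x) = (1 / p) (∑_{i < p ^ j} (p ^ j choose i) x ^ (s' i) c ^ (p ^ j - i) - c)`;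
the division is exact for `p` prime. -/
noncomputable def tPoly (c : ℤ) (p j s' : ℕ) : ℤ[X] :=
  divInt p
    ((∑ i ∈ Finset.range (p ^ j), C (((p ^ j).choose i : ℤ) * c ^ (p ^ j - i)) * X ^ (s' * i)) - C c)

/-- The case `p ∤ c a`, `p ∣ k`. Here `(1 / p) [(a ^ (p ^ j) - a) x ^ n - p m t(x) (x ^ k + c) ^ (m - 1)]`
is required to be coprime modulo `p` to `(x ^ s' + c) ^ m - a x ^ s`. -/
def CondV (a c : ℤ) (k m n p : ℕ) : Prop :=
  ¬ (p : ℤ) ∣ c * a ∧ p ∣ k ∧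
    ∃ j s s' : ℕ, k = p ^ j * s' ∧ n = p ^ j * s ∧ ¬ p ∣ Nat.gcd s s' ∧
      CoprimeMod p
        (divInt p (C (a ^ p ^ j - a) * X ^ n -
          C ((p : ℤ) * m) * tPoly c p j s' * (X ^ k + C c) ^ (m - 1)))
        (poly a c s' m s)

/-- The case `p ∤ c a k`, `p ∣ m`. -/
def CondVI (a c : ℤ) (k m n p : ℕ) : Prop :=
  ¬ (p : ℤ) ∣ c * a * k ∧ p ∣ m ∧ p ∣ n ∧ ¬ (p : ℤ) ^ 2 ∣ a ^ p - a

/-- The case `p ∤ c a k m`. -/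
def CondVII (a c : ℤ) (k m n p : ℕ) : Prop :=
  ¬ (p : ℤ) ∣ c * a * k * m ∧ ¬ (p : ℤ) ^ 2 ∣ calC c k m n - calE a k m n

/-- One of the seven conditions holds. -/
def Cond (a c : ℤ) (k m n p : ℕ) : Prop :=
  CondI a c m p ∨ CondII a c k m n p ∨ CondIII a c k m n p ∨ CondIV a c k m n p ∨
    CondV a c k m n p ∨ CondVI a c k m n p ∨ CondVII a c k m n p

end PolyFamily

/-!
By a criterion of Uchida, a prime `p` divides the index of `ℤ[θ]` in the ring of integers if and
only if the minimal polynomial `f` of `θ` lies in the square of a maximal ideal of `ℤ[X]` that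
contains `p` (`PolyFamily.dvd_index_iff`). Those ideals are the ideals `𝔪` of the integer polynomials
that vanish at a point `α` of an algebraic closure of `𝔽_p` (`PolyFamily.pointIdeal`), so the question
becomes one about the expansion of `f` modulo `𝔪 ^ 2` at its double roots `α` modulo `p`.

* If `f ≡ p B` modulo `𝔪 ^ 2`, then `f ∈ 𝔪 ^ 2` if and only if `B(α) = 0`
  (`PolyFamily.mem_sq_iff_of_sub_mem`). Such a `B` comes from the remark that `u ^ N ≡ v ^ N` modulo
  `𝔪 ^ 2` as soon as `u(α) = v(α)` and `p ∣ N` (`PolyFamily.pow_sub_pow_mem_sq`).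
* In most cases the equations for `α` are then `α ^ N = A` and `B α ^ n + D = 0` with integers
  `A, B, D`; their compatibility is an explicit congruence
  (`PolyFamily.exists_pow_eq_and_pow_eq_iff`), and this is where the expressions in the conditions
  come from.
* If `p` does not divide `c a k m`, the double roots satisfy `(k m - n) x ^ k = n c`, and expanding in
  powers of `U = (k m - n) x ^ k - n c ∈ 𝔪` shows that `f` is, up to a unit and modulo `𝔪 ^ 2`, the
  integer `𝒞 - ℰ` (`PolyFamily.mem_sq_iff_sq_dvd`).

A polynomial in `𝔪 ^ 2` has a double root at `α`, so prime divisors of the index divide the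
discriminant; this gives the last assertion. Conversely, that `p` divides the discriminant is what
forces `p ∣ n`, `p ∣ k` or `p ∣ k m - 1` in the cases where a condition demands it.
-/

namespace PolyFamily

/-! ### The maximal ideals of `ℤ[X]` above `p` -/

/-- Evaluation of an integer polynomial at a point `α` of the algebraic closure of `𝔽_p`. -/
noncomputable def evalAt (p : ℕ) [Fact p.Prime] (α : AlgebraicClosure (ZMod p)) :
    ℤ[X] →+* AlgebraicClosure (ZMod p) :=
  eval₂RingHom (Int.castRingHom _) α

/-- The ideal of the integer polynomials that vanish at the point `α` of the algebraic closure of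
`𝔽_p`. As `α` varies, these are exactly the maximal ideals of `ℤ[X]` that contain `p`. -/
noncomputable def pointIdeal (p : ℕ) [Fact p.Prime] (α : AlgebraicClosure (ZMod p)) : Ideal ℤ[X] :=
  RingHom.ker (evalAt p α)

section PointIdeal

variable {p : ℕ} [Fact p.Prime] {α : AlgebraicClosure (ZMod p)}

theorem mem_pointIdeal {g : ℤ[X]} : g ∈ pointIdeal p α ↔ evalAt p α g = 0 := RingHom.mem_ker

@[simp] theorem evalAt_X : evalAt p α X = α := by simp [evalAt]

@[simp] theorem evalAt_C (z : ℤ) : evalAt p α (C z) = z := by simp [evalAt]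

theorem intCast_eq_zero_iff {z : ℤ} : (z : AlgebraicClosure (ZMod p)) = 0 ↔ (p : ℤ) ∣ z :=
  CharP.intCast_eq_zero_iff _ p z

theorem evalAt_eq_aeval_map (g : ℤ[X]) :
    evalAt p α g = aeval α (g.map (Int.castRingHom (ZMod p))) := by
  rw [aeval_def, eval₂_map]
  simp only [evalAt, coe_eval₂RingHom]
  congr 1

theorem map_eq_zero_iff_C_dvd {g : ℤ[X]} :
    g.map (Int.castRingHom (ZMod p)) = 0 ↔ C (p : ℤ) ∣ g := by
  rw [C_dvd_iff_dvd_coeff]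
  simp [Polynomial.ext_iff, ZMod.intCast_zmod_eq_zero_iff_dvd]

theorem map_intCast_surjective :
    Function.Surjective (Polynomial.map (Int.castRingHom (ZMod p))) :=
  Polynomial.map_surjective _ (ZMod.ringHom_surjective _)

theorem mem_pointIdeal_iff_minpoly_dvd {g : ℤ[X]} :
    g ∈ pointIdeal p α ↔ minpoly (ZMod p) α ∣ g.map (Int.castRingHom (ZMod p)) := by
  rw [mem_pointIdeal, evalAt_eq_aeval_map, minpoly.dvd_iff]

theorem irreducible_minpoly : Irreducible (minpoly (ZMod p) α) :=
  minpoly.irreducible (Algebra.IsIntegral.isIntegral α)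

variable (p α) in
theorem exists_lift_minpoly :
    ∃ φ : ℤ[X], φ.map (Int.castRingHom (ZMod p)) = minpoly (ZMod p) α :=
  map_intCast_surjective _

theorem pointIdeal_eq_span {φ : ℤ[X]}
    (hφ : φ.map (Int.castRingHom (ZMod p)) = minpoly (ZMod p) α) :
    pointIdeal p α = Ideal.span {C (p : ℤ), φ} := by
  apply le_antisymm
  · intro g hg
    obtain ⟨q, hq⟩ := mem_pointIdeal_iff_minpoly_dvd.mp hg
    obtain ⟨r, rfl⟩ := map_intCast_surjective q
    have h : C (p : ℤ) ∣ g - φ * r := by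
      rw [← map_eq_zero_iff_C_dvd, Polynomial.map_sub, Polynomial.map_mul, hq, hφ, sub_self]
    obtain ⟨s, hs⟩ := h
    exact Ideal.mem_span_pair.mpr ⟨s, r, by linear_combination -hs⟩
  · rw [Ideal.span_le]
    rintro g (rfl | rfl)
    · simp [mem_pointIdeal]
    · exact mem_pointIdeal_iff_minpoly_dvd.mpr (hφ ▸ dvd_rfl)

theorem exists_mul_sub_one_mem {u : ℤ[X]} (hu : evalAt p α u ≠ 0) :
    ∃ w, w * u - 1 ∈ pointIdeal p α := by
  have h : ¬ minpoly (ZMod p) α ∣ u.map (Int.castRingHom (ZMod p)) := fun h =>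
    hu (mem_pointIdeal.mp (mem_pointIdeal_iff_minpoly_dvd.mpr h))
  obtain ⟨A, B, hAB⟩ := (irreducible_minpoly.coprime_iff_not_dvd.mpr h)
  obtain ⟨w, rfl⟩ := map_intCast_surjective B
  refine ⟨w, mem_pointIdeal_iff_minpoly_dvd.mpr ⟨-A, ?_⟩⟩
  simp only [Polynomial.map_sub, Polynomial.map_mul, Polynomial.map_one]
  linear_combination hAB

/-- The square of the maximal ideal of a point is primary. -/
theorem mem_sq_of_mul_mem_sq {u v : ℤ[X]} (hu : evalAt p α u ≠ 0)
    (h : u * v ∈ pointIdeal p α ^ 2) : v ∈ pointIdeal p α ^ 2 := by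
  obtain ⟨w, hw⟩ := exists_mul_sub_one_mem hu
  have h2 : (w * u - 1) ^ 2 * v ∈ pointIdeal p α ^ 2 :=
    Ideal.mul_mem_right _ _ (Ideal.pow_mem_pow hw 2)
  have h3 : (w * u * w - 2 * w) * (u * v) ∈ pointIdeal p α ^ 2 := Ideal.mul_mem_left _ _ h
  have : v = (w * u - 1) ^ 2 * v - (w * u * w - 2 * w) * (u * v) := by ring
  rw [this]
  exact sub_mem h2 h3

theorem mem_sq_iff_exists {φ : ℤ[X]}
    (hφ : φ.map (Int.castRingHom (ZMod p)) = minpoly (ZMod p) α) {g : ℤ[X]} :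
    g ∈ pointIdeal p α ^ 2 ↔
      ∃ A B D, g = C (p : ℤ) ^ 2 * A + C (p : ℤ) * φ * B + φ ^ 2 * D := by
  rw [pointIdeal_eq_span hφ, pow_two, Ideal.span_pair_mul_span_pair]
  simp only [Ideal.mem_span_insert, Ideal.mem_span_singleton']
  constructor
  · rintro ⟨A, _, ⟨B, _, ⟨B', _, ⟨D, rfl⟩, rfl⟩, rfl⟩, rfl⟩
    exact ⟨A, B + B', D, by ring⟩
  · rintro ⟨A, B, D, rfl⟩
    exact ⟨A, _, ⟨B, _, ⟨0, _, ⟨D, rfl⟩, rfl⟩, rfl⟩, by ring⟩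

/-- The points of the affine line over `ℤ` above `p` are unramified over `p`. -/
theorem C_notMem_sq : C (p : ℤ) ∉ pointIdeal p α ^ 2 := by
  obtain ⟨φ, hφ⟩ := exists_lift_minpoly p α
  rw [mem_sq_iff_exists hφ]
  rintro ⟨A, B, D, h⟩
  have h1 : D.map (Int.castRingHom (ZMod p)) = 0 := by
    have := congrArg (Polynomial.map (Int.castRingHom (ZMod p))) h
    simpa [hφ, irreducible_minpoly.ne_zero] using this
  obtain ⟨D', rfl⟩ := map_eq_zero_iff_C_dvd.mp h1
  have hp : C (p : ℤ) ≠ 0 := by simpa using (Fact.out : p.Prime).ne_zero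
  have h2 : (1 : ℤ[X]) = C (p : ℤ) * A + φ * B + φ ^ 2 * D' :=
    mul_left_cancel₀ hp (by linear_combination h)
  have h3 : evalAt p α φ = 0 := by
    rw [evalAt_eq_aeval_map, hφ, minpoly.aeval]
  simpa [h3] using congrArg (evalAt p α) h2

theorem C_mem_pointIdeal {z : ℤ} : C z ∈ pointIdeal p α ↔ (p : ℤ) ∣ z := by
  rw [mem_pointIdeal, evalAt_C, intCast_eq_zero_iff]

theorem C_mul_mem_sq_iff {B : ℤ[X]} :
    C (p : ℤ) * B ∈ pointIdeal p α ^ 2 ↔ evalAt p α B = 0 := by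
  constructor
  · intro h
    by_contra hB
    exact C_notMem_sq (mem_sq_of_mul_mem_sq hB (by rwa [mul_comm]))
  · intro h
    rw [pow_two]
    exact Ideal.mul_mem_mul (C_mem_pointIdeal.mpr dvd_rfl) (mem_pointIdeal.mpr h)

theorem C_mem_sq_iff {z : ℤ} : C z ∈ pointIdeal p α ^ 2 ↔ (p : ℤ) ^ 2 ∣ z := by
  constructor
  · intro h
    obtain ⟨b, rfl⟩ := C_mem_pointIdeal.mp (Ideal.pow_le_self two_ne_zero h)
    rw [C_mul, C_mul_mem_sq_iff, evalAt_C, intCast_eq_zero_iff] at h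
    rw [pow_two]
    exact mul_dvd_mul_left _ h
  · rintro ⟨b, rfl⟩
    rw [C_mul, C_pow]
    exact Ideal.mul_mem_right _ _ (Ideal.pow_mem_pow (C_mem_pointIdeal.mpr dvd_rfl) 2)

/-- The first order expansion `f ≡ p B` decides whether `f` lies in the square of the ideal. -/
theorem mem_sq_iff_of_sub_mem {f B : ℤ[X]} (h : f - C (p : ℤ) * B ∈ pointIdeal p α ^ 2) :
    f ∈ pointIdeal p α ^ 2 ↔ evalAt p α B = 0 := by
  rw [← C_mul_mem_sq_iff]
  exact ⟨fun hf => by simpa using sub_mem hf h, fun hf => by simpa using add_mem h hf⟩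

theorem mul_mem_sq {u v : ℤ[X]} (hu : evalAt p α u = 0) (hv : evalAt p α v = 0) :
    u * v ∈ pointIdeal p α ^ 2 := by
  rw [pow_two]
  exact Ideal.mul_mem_mul (mem_pointIdeal.mpr hu) (mem_pointIdeal.mpr hv)

/-- A polynomial in the square of the ideal of `α` has a double root at `α`. -/
theorem evalAt_eq_zero_of_mem_sq {f : ℤ[X]} (h : f ∈ pointIdeal p α ^ 2) :
    evalAt p α f = 0 ∧ evalAt p α (derivative f) = 0 := by
  rw [pow_two] at h
  induction h using Submodule.mul_induction_on' with
  | mem_mul_mem u hu v hv =>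
    rw [mem_pointIdeal] at hu hv
    simp [hu, hv]
  | add u hu v hv h1 h2 => simp [h1, h2]

/-- To first order, a power whose exponent is divisible by `p` depends only on the value of the
base at `α`. -/
theorem pow_sub_pow_mem_sq {u v : ℤ[X]} (huv : evalAt p α u = evalAt p α v) {N : ℕ}
    (hN : p ∣ N) : u ^ N - v ^ N ∈ pointIdeal p α ^ 2 := by
  obtain ⟨e, he⟩ := powAddExpansion v (u - v) N
  have h0 : evalAt p α (u - v) = 0 := by simp [huv]
  have h1 : evalAt p α ((N : ℤ[X]) * v ^ (N - 1)) = 0 := by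
    rw [map_mul, map_natCast, (CharP.cast_eq_zero_iff _ p N).mpr hN, zero_mul]
  rw [add_sub_cancel] at he
  have : u ^ N - v ^ N = (N * v ^ (N - 1)) * (u - v) + e * ((u - v) * (u - v)) := by
    rw [he]; ring
  rw [this]
  exact add_mem (mul_mem_sq h1 h0) (Ideal.mul_mem_left _ _ (mul_mem_sq h0 h0))

theorem pow_expChar_pow_inj {x y : AlgebraicClosure (ZMod p)} {j : ℕ} :
    x ^ p ^ j = y ^ p ^ j ↔ x = y := by
  constructor
  · intro h
    exact iterateFrobenius_inj (AlgebraicClosure (ZMod p)) p j (by simpa [iterateFrobenius_def])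
  · rintro rfl; rfl

theorem intCast_pow_prime_pow (z : ℤ) (j : ℕ) :
    (z : AlgebraicClosure (ZMod p)) ^ p ^ j = z := by
  induction j with
  | zero => simp
  | succ j ih =>
    rw [pow_succ, pow_mul, ih, ← map_intCast (algebraMap (ZMod p) (AlgebraicClosure (ZMod p))),
      ← map_pow, ZMod.pow_card]

theorem mul_frobQuot (z : ℤ) (j : ℕ) : (p : ℤ) * frobQuot p z j = z ^ p ^ j - z := by
  refine Int.mul_ediv_cancel' ?_
  rw [← intCast_eq_zero_iff]
  simp [intCast_pow_prime_pow]

/-- `p` divides the discriminant of `f` if and only if `f` has a double root modulo `p`. -/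
theorem dvd_discr_iff {f : ℤ[X]} (hf : f.Monic) (hd : 0 < f.natDegree) :
    (p : ℤ) ∣ f.discr ↔
      ∃ α : AlgebraicClosure (ZMod p), evalAt p α f = 0 ∧ evalAt p α (derivative f) = 0 := by
  let ι := Int.castRingHom (AlgebraicClosure (ZMod p))
  have h1 := resultant_deriv (natDegree_pos_iff_degree_pos.mp hd)
  have h2 := congrArg ι h1
  have hev : ∀ (α : AlgebraicClosure (ZMod p)) (g : ℤ[X]), (g.map ι).eval α = evalAt p α g :=
    fun α g => eval_map _ _
  rw [← resultant_map_map, ← hf.natDegree_map ι, resultant_eq_prod_eval _ _ _ ?_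
    (IsAlgClosed.splits _), (hf.map ι).leadingCoeff, one_pow, one_mul, hf.leadingCoeff, mul_one,
    map_mul] at h2
  · have h3 : ι ((-1) ^ ((f.map ι).natDegree * ((f.map ι).natDegree - 1) / 2)) ≠ 0 := by simp
    rw [← intCast_eq_zero_iff]
    change ι f.discr = 0 ↔ _
    rw [← mul_eq_zero_iff_left h3, ← h2, Multiset.prod_eq_zero_iff, Multiset.mem_map]
    simp only [mem_roots (hf.map ι).ne_zero, IsRoot, hev]
  · rw [hf.natDegree_map]
    exact natDegree_map_le.trans (natDegree_derivative_le f)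

end PointIdeal

/-- Two binomial equations in one unknown over an algebraically closed field. -/
theorem exists_pow_eq_and_pow_eq_iff {F : Type*} [Field F] [IsAlgClosed F] {u v : F}
    (hu : u ≠ 0) (hv : v ≠ 0) {k n : ℕ} (hk : 0 < k) :
    (∃ x : F, x ^ k = u ∧ x ^ n = v) ↔ u ^ (n / k.gcd n) = v ^ (k / k.gcd n) := by
  set d := k.gcd n with hd
  have hd0 : 0 < d := Nat.gcd_pos_of_pos_left _ hk
  obtain ⟨k', hk'⟩ : d ∣ k := Nat.gcd_dvd_left k n
  obtain ⟨n', hn'⟩ : d ∣ n := Nat.gcd_dvd_right k n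
  have e1 : k / d = k' := by rw [hk', Nat.mul_div_cancel_left _ hd0]
  have e2 : n / d = n' := by rw [hn', Nat.mul_div_cancel_left _ hd0]
  rw [e1, e2]
  constructor
  · rintro ⟨x, rfl, rfl⟩
    rw [← pow_mul, ← pow_mul]
    congr 1
    conv_lhs => rw [hk']
    conv_rhs => rw [hn']
    ring
  · intro h
    -- `x` is a `d`-th root of `u ^ A * v ^ B`, where `k * A + n * B = d`.
    have hb := Nat.gcd_eq_gcd_ab k n
    set A := k.gcdA n
    set B := k.gcdB n
    rw [← hd] at hb
    have hb' : (k' : ℤ) * A + n' * B = 1 := by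
      have hd1 : (d : ℤ) ≠ 0 := by positivity
      have a1 : (k : ℤ) = d * k' := by exact_mod_cast hk'
      have a2 : (n : ℤ) = d * n' := by exact_mod_cast hn'
      apply mul_left_cancel₀ hd1
      rw [a1, a2] at hb
      linear_combination -hb
    obtain ⟨x, hx⟩ := IsAlgClosed.exists_pow_nat_eq (u ^ A * v ^ B) hd0
    have h' : u ^ (n' : ℤ) = v ^ (k' : ℤ) := by exact_mod_cast h
    refine ⟨x, ?_, ?_⟩
    · rw [hk', pow_mul, hx, mul_pow, ← zpow_natCast, ← zpow_natCast, ← zpow_mul, ← zpow_mul,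
        mul_comm B, zpow_mul v, ← h', ← zpow_mul, ← zpow_add₀ hu]
      rw [show A * k' + n' * B = 1 by linear_combination hb', zpow_one]
    · rw [hn', pow_mul, hx, mul_pow, ← zpow_natCast, ← zpow_natCast, ← zpow_mul, ← zpow_mul,
        mul_comm A, zpow_mul u, h', ← zpow_mul, ← zpow_add₀ hv]
      rw [show k' * A + B * n' = 1 by linear_combination hb', zpow_one]

/-! ### The index of `ℤ[θ]` -/

section Index

variable {O : Type*} [CommRing O] (θ : O)

theorem mem_adjoin_iff_exists_aeval {y : O} :
    y ∈ Algebra.adjoin ℤ {θ} ↔ ∃ g : ℤ[X], aeval θ g = y := by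
  rw [Algebra.adjoin_singleton_eq_range_aeval]; rfl

/-- The ideal of the integer polynomials `g` with `g(θ) y ∈ ℤ[θ]`. -/
def denomIdeal (y : O) : Ideal ℤ[X] where
  carrier := {g | aeval θ g * y ∈ Algebra.adjoin ℤ {θ}}
  add_mem' {g h} hg hh := by
    simp only [Set.mem_ofPred_eq] at hg hh ⊢
    rw [map_add, add_mul]
    exact add_mem hg hh
  zero_mem' := by simp
  smul_mem' r g hg := by
    simp only [Set.mem_ofPred_eq] at hg ⊢
    rw [smul_eq_mul, map_mul, mul_assoc]
    exact mul_mem ((mem_adjoin_iff_exists_aeval θ).mpr ⟨r, rfl⟩) hg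

variable {θ}

theorem mem_denomIdeal {y : O} {g : ℤ[X]} :
    g ∈ denomIdeal θ y ↔ aeval θ g * y ∈ Algebra.adjoin ℤ {θ} := Iff.rfl

/-- If `p` sends some element outside `ℤ[θ]` into `ℤ[θ]`, then it does so for an element whose
annihilator modulo `ℤ[θ]`, an ideal of `ℤ[X]`, is prime: a maximal annihilator is. -/
theorem exists_isPrime_denomIdeal {p : ℕ} {y : O} (hy : y ∉ Algebra.adjoin ℤ {θ})
    (hpy : (p : O) * y ∈ Algebra.adjoin ℤ {θ}) :
    ∃ z, z ∉ Algebra.adjoin ℤ {θ} ∧ C (p : ℤ) ∈ denomIdeal θ z ∧ (denomIdeal θ z).IsPrime := by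
  obtain ⟨P, ⟨z, hz, hpz, rfl⟩, hmax⟩ := set_has_maximal_iff_noetherian.mpr
    (inferInstance : IsNoetherian ℤ[X] ℤ[X])
    {J : Ideal ℤ[X] | ∃ z, z ∉ Algebra.adjoin ℤ {θ} ∧ C (p : ℤ) ∈ denomIdeal θ z ∧
      J = denomIdeal θ z} ⟨_, y, hy, by simpa [mem_denomIdeal] using hpy, rfl⟩
  refine ⟨z, hz, hpz, ⟨?_, ?_⟩⟩
  · rw [Ideal.ne_top_iff_one, mem_denomIdeal]
    simpa using hz
  · intro g h hgh
    by_contra hcon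
    rw [not_or] at hcon
    obtain ⟨hg, hh⟩ := hcon
    have hle : denomIdeal θ z ≤ denomIdeal θ (aeval θ g * z) := fun r hr => by
      rw [mem_denomIdeal, mul_left_comm]
      exact mul_mem ((mem_adjoin_iff_exists_aeval θ).mpr ⟨g, rfl⟩) hr
    refine hmax _ ⟨aeval θ g * z, hg, hle hpz, rfl⟩ (lt_of_le_of_ne hle fun heq => hh ?_)
    rw [heq, mem_denomIdeal, ← mul_assoc, ← map_mul, mul_comm h g]
    exact hgh

/-- A prime ideal of `ℤ[X]` containing `p` and a monic polynomial is the ideal of a point. -/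
theorem exists_eq_pointIdeal {p : ℕ} [Fact p.Prime] {P : Ideal ℤ[X]} [P.IsPrime] {f : ℤ[X]}
    (hf : f.Monic) (hfP : f ∈ P) (hp : C (p : ℤ) ∈ P) :
    ∃ α : AlgebraicClosure (ZMod p), P = pointIdeal p α := by
  let ρ := mapRingHom (Int.castRingHom (ZMod p))
  have hρ : Function.Surjective ρ := map_intCast_surjective
  have hker : RingHom.ker ρ ≤ P := fun g hg => by
    obtain ⟨h, rfl⟩ := map_eq_zero_iff_C_dvd.mp (by simpa [ρ] using hg)
    exact Ideal.mul_mem_right _ _ hp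
  have hprime : (P.map ρ).IsPrime := Ideal.map_isPrime_of_surjective hρ hker
  have hne : P.map ρ ≠ ⊥ := fun h => by
    have := Ideal.mem_map_of_mem ρ hfP
    rw [h, Ideal.mem_bot] at this
    exact (hf.map (Int.castRingHom (ZMod p))).ne_zero (by simpa [ρ] using this)
  have hmax : (P.map ρ).IsMaximal := hprime.isMaximal hne
  obtain ⟨ψ, hψ⟩ := (IsPrincipalIdealRing.principal (P.map ρ)).principal
  have hψ' : P.map ρ = Ideal.span {ψ} := hψ
  have hdeg : ψ.degree ≠ 0 := fun h => hprime.ne_top (by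
    rw [hψ', Ideal.span_singleton_eq_top]
    exact isUnit_iff_degree_eq_zero.mpr h)
  obtain ⟨α, hα⟩ := IsAlgClosed.exists_aeval_eq_zero (AlgebraicClosure (ZMod p)) ψ hdeg
  have hle : P.map ρ ≤ RingHom.ker (aeval (R := ZMod p) α) := by
    rw [hψ', Ideal.span_singleton_le_iff_mem, RingHom.mem_ker, hα]
  have heq := hmax.eq_of_le (RingHom.ker_ne_top _) hle
  refine ⟨α, ?_⟩
  ext g
  rw [mem_pointIdeal, evalAt_eq_aeval_map, ← RingHom.mem_ker, ← heq]
  change g ∈ P ↔ ρ g ∈ P.map ρ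
  rw [← Ideal.mem_comap, Ideal.comap_map_of_surjective' ρ hρ, sup_eq_left.mpr hker]

/-- If `p` times an integral element outside `ℤ[θ]` lies in `ℤ[θ]`, then the minimal polynomial
`f` of `θ` lies in the square of the ideal of some point. -/
theorem exists_mem_sq_of_notMem_adjoin [IsDomain O] [Algebra.IsIntegral ℤ O] {p : ℕ} [Fact p.Prime]
    (hp0 : (p : O) ≠ 0) {f : ℤ[X]} (hf : f.Monic) (hker : ∀ g : ℤ[X], aeval θ g = 0 ↔ f ∣ g)
    {y : O} (hy : y ∉ Algebra.adjoin ℤ {θ}) (hpy : (p : O) * y ∈ Algebra.adjoin ℤ {θ}) :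
    ∃ α : AlgebraicClosure (ZMod p), f ∈ pointIdeal p α ^ 2 := by
  obtain ⟨z, hz, hpz, hprime⟩ := exists_isPrime_denomIdeal hy hpy
  have hfz : f ∈ denomIdeal θ z := by
    rw [mem_denomIdeal, (hker f).mpr dvd_rfl, zero_mul]
    exact zero_mem _
  obtain ⟨α, hα⟩ := exists_eq_pointIdeal hf hfz hpz
  refine ⟨α, ?_⟩
  -- by lying over, `z` multiplies the maximal ideal of `ℤ[θ]` at `α` into itself
  have hstable : ∀ g ∈ pointIdeal p α, ∃ u ∈ pointIdeal p α, aeval θ u = aeval θ g * z := by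
    let _ : Algebra ℤ[X] O := (aeval θ).toRingHom.toAlgebra
    have halg : ∀ g : ℤ[X], algebraMap ℤ[X] O g = aeval θ g := fun _ => rfl
    have : IsScalarTower ℤ ℤ[X] O := IsScalarTower.of_algebraMap_eq' (RingHom.ext_int _ _)
    have : Algebra.IsIntegral ℤ[X] O := Algebra.IsIntegral.tower_top ℤ
    obtain ⟨Q, -, hQ, hQc⟩ := Ideal.exists_ideal_over_prime_of_isIntegral
      (denomIdeal θ z) (⊥ : Ideal O) (fun g hg => by
        rw [Ideal.mem_comap, Ideal.mem_bot, halg, hker] at hg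
        exact Ideal.mem_of_dvd _ hg hfz)
    rw [hα] at hQc
    intro g hg
    have hg' := hg
    rw [← hα, mem_denomIdeal, mem_adjoin_iff_exists_aeval] at hg'
    obtain ⟨u, hu⟩ := hg'
    refine ⟨u, ?_, hu⟩
    rw [← hQc, Ideal.mem_comap, halg] at hg ⊢
    rw [hu]
    exact Ideal.mul_mem_right _ _ hg
  obtain ⟨φ, hφ⟩ := exists_lift_minpoly p α
  have hφm : φ ∈ pointIdeal p α := mem_pointIdeal_iff_minpoly_dvd.mpr (hφ ▸ dvd_rfl)
  obtain ⟨u, hum, hu⟩ := hstable _ (C_mem_pointIdeal.mpr (dvd_refl (p : ℤ)))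
  obtain ⟨v, hvm, hv⟩ := hstable _ hφm
  rw [aeval_C] at hu
  obtain ⟨q, hq⟩ : f ∣ φ * u - C (p : ℤ) * v := by
    rw [← hker]
    simp only [map_sub, map_mul, hu, hv, aeval_C]
    ring
  by_cases hqm : q ∈ pointIdeal p α
  · exfalso
    rw [pointIdeal_eq_span hφ, Ideal.mem_span_pair] at hqm
    obtain ⟨A, B, rfl⟩ := hqm
    obtain ⟨w, hw⟩ : C (p : ℤ) ∣ u - f * B := by
      have h : C (p : ℤ) ∣ φ * (u - f * B) := ⟨v + f * A, by linear_combination hq⟩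
      rw [← map_eq_zero_iff_C_dvd, Polynomial.map_mul, hφ] at h
      exact map_eq_zero_iff_C_dvd.mp ((mul_eq_zero.mp h).resolve_left irreducible_minpoly.ne_zero)
    apply hz
    rw [mem_adjoin_iff_exists_aeval]
    refine ⟨w, mul_left_cancel₀ hp0 ?_⟩
    have h := congrArg (aeval θ) hw
    simp only [map_sub, map_mul, (hker f).mpr dvd_rfl, hu, aeval_C] at h
    simpa using h.symm
  · refine mem_sq_of_mul_mem_sq (mt mem_pointIdeal.mpr hqm) (v := f) ?_
    rw [mul_comm, ← hq, pow_two]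
    exact sub_mem (Ideal.mul_mem_mul hφm hum)
      (Ideal.mul_mem_mul (C_mem_pointIdeal.mpr dvd_rfl) hvm)

/-- If `f = p² A + p φ B + φ² D` lies in the square of the ideal of a point, then
`φ(θ) D(θ) / p` is a root of `y² + B(θ) y + A(θ) D(θ)`; it lies outside `ℤ[θ]`. -/
theorem exists_notMem_adjoin_of_mem_sq {K : Type*} [Field K] [CharZero K] [Algebra O K]
    [IsFractionRing O K] [IsDomain O] [IsIntegrallyClosed O] {p : ℕ} [Fact p.Prime]
    {f : ℤ[X]} (hf : f.Monic) (hker : ∀ g : ℤ[X], aeval θ g = 0 ↔ f ∣ g)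
    {α : AlgebraicClosure (ZMod p)} (hα : f ∈ pointIdeal p α ^ 2) :
    ∃ y : O, y ∉ Algebra.adjoin ℤ {θ} ∧ (p : O) * y ∈ Algebra.adjoin ℤ {θ} := by
  obtain ⟨φ, hφ⟩ := exists_lift_minpoly p α
  obtain ⟨A, B, D, hABD⟩ := (mem_sq_iff_exists hφ).mp hα
  have hpK : (p : K) ≠ 0 := by exact_mod_cast (Fact.out : p.Prime).ne_zero
  let j := algebraMap O K
  have hrel : (p : O) ^ 2 * aeval θ A + p * aeval θ φ * aeval θ B + aeval θ φ ^ 2 * aeval θ D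
      = 0 := by
    have h := congrArg (aeval θ) hABD
    rw [(hker f).mpr dvd_rfl] at h
    simpa using h.symm
  have hrelK := congrArg j hrel
  simp only [map_add, map_mul, map_pow, map_natCast, map_zero] at hrelK
  have hint : IsIntegral O (j (aeval θ φ) * j (aeval θ D) / p) := by
    refine ⟨X ^ 2 + C (aeval θ B) * X + C (aeval θ A * aeval θ D), by monicity!, ?_⟩
    simp only [eval₂_add, eval₂_pow, eval₂_X, eval₂_mul, eval₂_C]
    change _ + j _ * _ + j _ = 0
    rw [map_mul]
    field_simp
    linear_combination j (aeval θ D) * hrelK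
  obtain ⟨y, hy⟩ := IsIntegrallyClosed.isIntegral_iff.mp hint
  have hpy : (p : O) * y = aeval θ (φ * D) := by
    apply IsFractionRing.injective O K
    rw [map_mul, map_natCast, hy, map_mul, map_mul]
    field_simp
    rfl
  refine ⟨y, fun hmem => ?_, ?_⟩
  · obtain ⟨w, rfl⟩ := (mem_adjoin_iff_exists_aeval θ).mp hmem
    obtain ⟨v, hv⟩ : f ∣ φ * D - C (p : ℤ) * w := by
      rw [← hker, map_sub, ← hpy]
      simp
    have h1 := congrArg (Polynomial.map (Int.castRingHom (ZMod p))) hv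
    have h2 := congrArg (Polynomial.map (Int.castRingHom (ZMod p))) hABD
    have hCp : (C (p : ℤ)).map (Int.castRingHom (ZMod p)) = 0 := by simp
    simp only [Polynomial.map_sub, Polynomial.map_mul, Polynomial.map_add, Polynomial.map_pow, hCp,
      zero_mul, sub_zero, zero_pow two_ne_zero, zero_add, hφ] at h1 h2
    set ψ := minpoly (ZMod p) α
    have hψ : Irreducible ψ := irreducible_minpoly
    have hD : D.map (Int.castRingHom (ZMod p)) ≠ 0 := fun h0 =>
      (hf.map (Int.castRingHom (ZMod p))).ne_zero (by rw [h2, h0, mul_zero])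
    rw [h2] at h1
    refine hψ.not_isUnit (IsUnit.of_mul_eq_one (v.map (Int.castRingHom (ZMod p))) ?_)
    apply mul_left_cancel₀ (mul_ne_zero hψ.ne_zero hD)
    linear_combination -h1
  · rw [hpy]
    exact (mem_adjoin_iff_exists_aeval θ).mpr ⟨_, rfl⟩

end Index

section NumberField

open NumberField

variable {K : Type*} [Field K] [NumberField K] {θ : 𝓞 K}

/-- The subring generated by a primitive element has finite index. -/
theorem index_adjoin_ne_zero (hK : IntermediateField.adjoin ℚ {(θ : K)} = ⊤) :
    (Subalgebra.toSubmodule (Algebra.adjoin ℤ {θ})).toAddSubgroup.index ≠ 0 := by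
  have hfin : Finite (𝓞 K ⧸ Subalgebra.toSubmodule (Algebra.adjoin ℤ {θ})) := by
    refine Module.finite_of_fg_torsion _ fun x => ?_
    obtain ⟨y, rfl⟩ := Submodule.Quotient.mk_surjective _ x
    have htop : Algebra.adjoin ℚ {(θ : K)} = ⊤ := by
      rw [← IntermediateField.adjoin_simple_toSubalgebra_of_isAlgebraic
        (Algebra.IsAlgebraic.isAlgebraic (R := ℚ) (θ : K)), hK, IntermediateField.top_toSubalgebra]
    have hy : (y : K) ∈ Algebra.adjoin ℚ {(θ : K)} := htop ▸ Algebra.mem_top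
    rw [Algebra.adjoin_singleton_eq_range_aeval] at hy
    obtain ⟨q, hq⟩ := hy
    obtain ⟨b, hbM, hb⟩ := IsLocalization.integerNormalization_spec (nonZeroDivisors ℤ) q
    refine ⟨⟨b, hbM⟩, (Submodule.Quotient.mk_eq_zero _).mpr ?_⟩
    rw [Subalgebra.mem_toSubmodule]
    refine (mem_adjoin_iff_exists_aeval θ).mpr
      ⟨IsLocalization.integerNormalization (nonZeroDivisors ℤ) q, ?_⟩
    apply RingOfIntegers.coe_injective
    have h := congrArg (aeval (θ : K)) hb
    rw [aeval_map_algebraMap] at h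
    rw [← aeval_algebraMap_apply, h, map_zsmul]
    have hq' : aeval (θ : K) q = y := hq
    rw [hq']
    exact (map_zsmul (algebraMap (𝓞 K) K) b y).symm
  have : Finite (𝓞 K ⧸ (Subalgebra.toSubmodule (Algebra.adjoin ℤ {θ})).toAddSubgroup) := hfin
  exact AddSubgroup.index_ne_zero_of_finite

/-- **Uchida's criterion**: `p` divides the index of `ℤ[θ]` if and only if the minimal polynomial
of `θ` lies in the square of a maximal ideal of `ℤ[X]` that contains `p`. -/
theorem dvd_index_iff (hK : IntermediateField.adjoin ℚ {(θ : K)} = ⊤) {p : ℕ} [Fact p.Prime] :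
    p ∣ (Subalgebra.toSubmodule (Algebra.adjoin ℤ {θ})).toAddSubgroup.index ↔
      ∃ α : AlgebraicClosure (ZMod p), minpoly ℤ θ ∈ pointIdeal p α ^ 2 := by
  set H := (Subalgebra.toSubmodule (Algebra.adjoin ℤ {θ})).toAddSubgroup with hH
  have hmem : ∀ y, y ∈ H ↔ y ∈ Algebra.adjoin ℤ {θ} := fun y => Iff.rfl
  have hint : IsIntegral ℤ θ := Algebra.IsIntegral.isIntegral θ
  have hmonic := minpoly.monic hint
  have hker : ∀ g : ℤ[X], aeval θ g = 0 ↔ minpoly ℤ θ ∣ g := fun g =>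
    minpoly.isIntegrallyClosed_dvd_iff hint g
  have hmk : ∀ y : 𝓞 K, p • (QuotientAddGroup.mk y : 𝓞 K ⧸ H) = 0 ↔
      (p : 𝓞 K) * y ∈ Algebra.adjoin ℤ {θ} := fun y => by
    rw [← QuotientAddGroup.mk_nsmul, QuotientAddGroup.eq_zero_iff, hmem, nsmul_eq_mul]
  constructor
  · intro h
    have : Finite (𝓞 K ⧸ H) := 
      Nat.finite_of_card_ne_zero (index_adjoin_ne_zero hK)
    obtain ⟨x, hx⟩ := exists_prime_addOrderOf_dvd_card' p (G := 𝓞 K ⧸ H) h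
    obtain ⟨y, rfl⟩ := QuotientAddGroup.mk_surjective x
    refine exists_mem_sq_of_notMem_adjoin (θ := θ) (y := y) ?_ hmonic hker ?_ ?_
    · exact_mod_cast (Fact.out : p.Prime).ne_zero
    · rw [← hmem, ← QuotientAddGroup.eq_zero_iff]
      intro h0
      rw [h0, addOrderOf_zero] at hx
      exact (Fact.out : p.Prime).one_lt.ne hx
    · rw [← hmk, ← hx, addOrderOf_nsmul_eq_zero]
  · rintro ⟨α, hα⟩
    obtain ⟨y, hy, hpy⟩ := exists_notMem_adjoin_of_mem_sq (K := K) hmonic hker hα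
    rw [← addOrderOf_eq_prime ((hmk y).mpr hpy)
      (fun h0 => hy ((hmem y).mp ((QuotientAddGroup.eq_zero_iff y).mp h0)))]
    exact addOrderOf_dvd_natCard _

end NumberField

theorem C_mul_C_ediv {p : ℕ} {b : ℤ} (hb : (p : ℤ) ∣ b) : C (p : ℤ) * C (b / p) = C b := by
  rw [← C_mul, Int.mul_ediv_cancel' hb]

/-! ### First order expansions -/

section Cases

variable {p : ℕ} [Fact p.Prime] {α : AlgebraicClosure (ZMod p)} {a c : ℤ} {k m n : ℕ}

theorem natCast_eq_zero_iff {N : ℕ} : (N : AlgebraicClosure (ZMod p)) = 0 ↔ p ∣ N :=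
  CharP.cast_eq_zero_iff _ p N

theorem prime_intCast : Prime (p : ℤ) := Nat.prime_iff_prime_int.mp Fact.out

theorem evalAt_poly : evalAt p α (poly a c k m n) = (α ^ k + c) ^ m - a * α ^ n := by
  simp only [poly, map_sub, map_mul, map_pow, map_add, evalAt_X, evalAt_C]

theorem evalAt_derivative_poly : evalAt p α (derivative (poly a c k m n)) =
    m * (α ^ k + c) ^ (m - 1) * (k * α ^ (k - 1)) - a * (n * α ^ (n - 1)) := by
  simp only [poly, derivative_pow, derivative_C, derivative_X,
    derivative_mul, map_sub, map_mul, map_add, map_pow, evalAt_X, evalAt_C, map_natCast, map_zero,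
    map_one]
  simp

/-- At a double root, Euler's relation `x f' - n f = (x ^ k + c) ^ (m - 1) ((k m - n) x ^ k - n c)`
eliminates the term `a x ^ n`. -/
theorem euler_relation (hk : 0 < k) (hm : 0 < m) (hn : 0 < n)
    (h0 : evalAt p α (poly a c k m n) = 0) (h1 : evalAt p α (derivative (poly a c k m n)) = 0) :
    (α ^ k + c) ^ (m - 1) * ((k * m - n) * α ^ k - n * c) = 0 := by
  obtain ⟨k, rfl⟩ := Nat.exists_eq_add_one.mpr hk
  obtain ⟨m, rfl⟩ := Nat.exists_eq_add_one.mpr hm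
  obtain ⟨n, rfl⟩ := Nat.exists_eq_add_one.mpr hn
  rw [evalAt_poly] at h0
  rw [evalAt_derivative_poly] at h1
  simp only [add_tsub_cancel_right] at h1 ⊢
  push_cast at h0 h1 ⊢
  linear_combination α * h1 - (n + 1) * h0

/-- The system `x ^ N = A`, `B x ^ n + D = 0` modulo `p`. If `p` divides exactly one of `B` and `D`
there is no solution, since `x` is nonzero. -/
theorem exists_root_iff {A B D : ℤ} {N n : ℕ} (hA : ¬ (p : ℤ) ∣ A) (hN : 0 < N) :
    (∃ α : AlgebraicClosure (ZMod p), α ^ N = A ∧ B * α ^ n + D = 0) ↔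
      ((p : ℤ) ∣ B ∧ (p : ℤ) ∣ D) ∨ (¬ (p : ℤ) ∣ B ∧ ¬ (p : ℤ) ∣ D ∧
        (p : ℤ) ∣ A ^ (n / N.gcd n) * B ^ (N / N.gcd n) - (-D) ^ (N / N.gcd n)) := by
  simp only [← intCast_eq_zero_iff] at hA ⊢
  push_cast
  have hα : ∀ α : AlgebraicClosure (ZMod p), α ^ N = A → α ≠ 0 := by
    rintro α h rfl
    rw [zero_pow hN.ne'] at h
    exact hA h.symm
  by_cases hB : (B : AlgebraicClosure (ZMod p)) = 0
  · simp only [hB, zero_mul, zero_add, true_and, not_true, false_and, or_false]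
    constructor
    · rintro ⟨-, -, h⟩
      exact h
    · intro h
      obtain ⟨x, hx⟩ := IsAlgClosed.exists_pow_nat_eq (A : AlgebraicClosure (ZMod p)) hN
      exact ⟨x, hx, h⟩
  by_cases hD : (D : AlgebraicClosure (ZMod p)) = 0
  · simp only [hB, hD, false_and, not_true, and_false, or_false, iff_false]
    rintro ⟨α, h1, h2⟩
    simp [hB, hα α h1] at h2
  · have hv : -(D : AlgebraicClosure (ZMod p)) / B ≠ 0 := div_ne_zero (neg_ne_zero.mpr hD) hB
    have hiff := exists_pow_eq_and_pow_eq_iff (n := n) hA hv hN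
    simp only [hB, hD, false_and, not_false_eq_true, true_and, false_or]
    rw [div_pow, eq_div_iff (pow_ne_zero _ hB), ← sub_eq_zero] at hiff
    rw [← hiff]
    refine exists_congr fun α => and_congr_right fun _ => ?_
    rw [eq_div_iff hB, mul_comm, eq_neg_iff_add_eq_zero]

theorem not_exists_root_iff {A B D : ℤ} {N n : ℕ} (hA : ¬ (p : ℤ) ∣ A) (hN : 0 < N) :
    (¬ ∃ α : AlgebraicClosure (ZMod p), α ^ N = A ∧ B * α ^ n + D = 0) ↔
      ((p : ℤ) ∣ B ∧ ¬ (p : ℤ) ∣ D) ∨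
        ¬ (p : ℤ) ∣ B * (A ^ (n / N.gcd n) * B ^ (N / N.gcd n) - (-D) ^ (N / N.gcd n)) := by
  have hg : N / N.gcd n ≠ 0 := (Nat.div_gcd_pos_of_pos_left n hN).ne'
  rw [exists_root_iff hA hN, prime_intCast.dvd_mul]
  have h1 : ¬ (p : ℤ) ∣ B → (p : ℤ) ∣ D →
      ¬ (p : ℤ) ∣ A ^ (n / N.gcd n) * B ^ (N / N.gcd n) - (-D) ^ (N / N.gcd n) := by
    intro hB hD h
    rw [dvd_sub_left (dvd_pow ((dvd_neg).mpr hD) hg), prime_intCast.dvd_mul] at h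
    exact h.elim (fun h => hA (prime_intCast.dvd_of_dvd_pow h))
      (fun h => hB (prime_intCast.dvd_of_dvd_pow h))
  tauto

theorem not_exists_root_iff' {A B D : ℤ} {N n : ℕ} (hA : ¬ (p : ℤ) ∣ A) (hN : 0 < N) :
    (¬ ∃ α : AlgebraicClosure (ZMod p), α ^ N = A ∧ B * α ^ n + D = 0) ↔
      ((p : ℤ) ∣ D ∧ ¬ (p : ℤ) ∣ B) ∨
        ¬ (p : ℤ) ∣ D * (A ^ (n / N.gcd n) * B ^ (N / N.gcd n) - (-D) ^ (N / N.gcd n)) := by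
  have hg : N / N.gcd n ≠ 0 := (Nat.div_gcd_pos_of_pos_left n hN).ne'
  rw [exists_root_iff hA hN, prime_intCast.dvd_mul]
  have h1 : (p : ℤ) ∣ B → ¬ (p : ℤ) ∣ D →
      ¬ (p : ℤ) ∣ A ^ (n / N.gcd n) * B ^ (N / N.gcd n) - (-D) ^ (N / N.gcd n) := by
    intro hB hD h
    rw [dvd_sub_right (Dvd.dvd.mul_left (dvd_pow hB hg) _)] at h
    exact hD ((dvd_neg).mp (prime_intCast.dvd_of_dvd_pow h))
  tauto

theorem sq_dvd_iff {z : ℤ} (hz : (p : ℤ) ∣ z) : (p : ℤ) ^ 2 ∣ z ↔ (p : ℤ) ∣ z / p := by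
  obtain ⟨b, rfl⟩ := hz
  have hp : (p : ℤ) ≠ 0 := prime_intCast.ne_zero
  rw [Int.mul_ediv_cancel_left _ hp, pow_two, mul_dvd_mul_iff_left hp]

/-! ### Primes dividing `c` -/

/-- At the root `0` the terms `x ^ k` and `a x ^ n` vanish to second order, so that only the
constant term `c` can keep `f` out of the square of the ideal. -/
theorem poly_mem_sq_zero_iff (hn : 1 ≤ n) (hkm : n < k * m) (hc : (p : ℤ) ∣ c)
    (h : (p : ℤ) ∣ a ∨ 2 ≤ n) :
    poly a c k m n ∈ pointIdeal p 0 ^ 2 ↔ ¬ (m = 1 ∧ ¬ (p : ℤ) ^ 2 ∣ c) := by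
  have hX : (X : ℤ[X]) ∈ pointIdeal p 0 := by simp [mem_pointIdeal]
  have hXpow : ∀ N, 2 ≤ N → (X : ℤ[X]) ^ N ∈ pointIdeal p 0 ^ 2 := fun N hN =>
    Ideal.pow_le_pow_right hN (Ideal.pow_mem_pow hX N)
  have ha : C a * X ^ n ∈ pointIdeal p 0 ^ 2 := by
    rcases h with h | h
    · exact mul_mem_sq (by rwa [evalAt_C, intCast_eq_zero_iff]) (by simp; omega)
    · exact Ideal.mul_mem_left _ _ (hXpow n h)
  rw [poly, Submodule.sub_mem_iff_left _ ha]
  have hm : m ≠ 0 := by rintro rfl; simp at hkm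
  have hk : k ≠ 0 := by rintro rfl; simp at hkm
  by_cases hm1 : m = 1
  · subst hm1
    rw [pow_one, Submodule.add_mem_iff_right _ (hXpow k (by omega)), C_mem_sq_iff]
    simp
  · simp only [hm1, false_and, not_false_eq_true, iff_true]
    refine Ideal.pow_le_pow_right (by omega : 2 ≤ m) (Ideal.pow_mem_pow ?_ m)
    simp [mem_pointIdeal, hk, intCast_eq_zero_iff.mpr hc]

theorem exists_mem_sq_iff_of_dvd_of_dvd (hn : 1 ≤ n) (hkm : n < k * m) (hc : (p : ℤ) ∣ c)
    (ha : (p : ℤ) ∣ a) :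
    (∃ α, poly a c k m n ∈ pointIdeal p α ^ 2) ↔ ¬ (m = 1 ∧ ¬ (p : ℤ) ^ 2 ∣ c) := by
  rw [← poly_mem_sq_zero_iff hn hkm hc (Or.inl ha)]
  refine ⟨?_, fun h => ⟨0, h⟩⟩
  rintro ⟨α, h⟩
  have h0 := (evalAt_eq_zero_of_mem_sq h).1
  rw [evalAt_poly, intCast_eq_zero_iff.mpr hc, intCast_eq_zero_iff.mpr ha, add_zero, zero_mul,
    sub_zero, ← pow_mul] at h0
  rwa [eq_zero_of_pow_eq_zero h0] at h

theorem root_pow_eq (hc : (p : ℤ) ∣ c) (hkm : n < k * m) (hα : α ≠ 0)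
    (h0 : evalAt p α (poly a c k m n) = 0) : α ^ (k * m - n) = a := by
  rw [evalAt_poly, intCast_eq_zero_iff.mpr hc, add_zero, ← pow_mul] at h0
  apply mul_right_cancel₀ (pow_ne_zero n hα)
  rw [← pow_add, Nat.sub_add_cancel hkm.le]
  linear_combination h0

/-- If `α ^ N = b` and `p ∣ N`, then `x ^ N ≡ b ^ (p ^ v_p(N))` to first order at `α`. -/
theorem pow_sub_C_mem_sq {N : ℕ} {b : ℤ} (hN : N ≠ 0) (hpN : p ∣ N) (h : α ^ N = b) :
    X ^ N - C (b ^ p ^ padicValNat p N) ∈ pointIdeal p α ^ 2 := by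
  obtain ⟨u, hu⟩ : p ^ padicValNat p N ∣ N := pow_padicValNat_dvd
  have hl : padicValNat p N ≠ 0 := Nat.one_le_iff_ne_zero.mp (one_le_padicValNat_of_dvd hN hpN)
  set l := padicValNat p N
  have hb : evalAt p α (X ^ u) = evalAt p α (C b) := by
    rw [map_pow, evalAt_X, evalAt_C, ← pow_expChar_pow_inj (j := l), ← pow_mul, mul_comm, ← hu, h,
      intCast_pow_prime_pow]
  have := pow_sub_pow_mem_sq hb (dvd_pow_self p hl)
  rwa [← pow_mul, mul_comm u, ← hu, ← C_pow] at this

theorem C_mul_C_frobQuot (b : ℤ) (j : ℕ) :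
    C (p : ℤ) * C (frobQuot p b j) = C (b ^ p ^ j) - C b := by
  rw [← C_mul, mul_frobQuot, C_sub]

/-- For `p ∣ c` and `n = 1` the root `0` is simple. -/
theorem ne_zero_of_derivative_eq_zero (hkm : 1 < k * m) (hc : (p : ℤ) ∣ c) (ha : ¬ (p : ℤ) ∣ a)
    (h1 : evalAt p α (derivative (poly a c k m 1)) = 0) : α ≠ 0 := by
  rintro rfl
  have ha0 : (a : AlgebraicClosure (ZMod p)) ≠ 0 := by rwa [Ne, intCast_eq_zero_iff]
  rw [evalAt_derivative_poly, intCast_eq_zero_iff.mpr hc] at h1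
  by_cases hk1 : k = 1
  · have hm1 : m - 1 ≠ 0 := by rintro h; subst hk1; omega
    simp [hk1, hm1, ha0] at h1
  · have hk : k ≠ 0 := by rintro rfl; simp at hkm
    have hk2 : k - 1 ≠ 0 := by omega
    simp [hk2, ha0] at h1

/-- For `p ∣ c` and `n = 1`, at a root `α` of `x ^ (k m - 1) - a` one has
`f ≡ p (a₁ x + m c₂ x ^ (k (m - 1)))` to first order, where `p a₁ = a ^ (p ^ j) - a` and
`p c₂ = c`. -/
theorem exists_mem_sq_iff_of_dvd_of_not_dvd_one (hkm : 1 < k * m) (hc : (p : ℤ) ∣ c)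
    (ha : ¬ (p : ℤ) ∣ a) (hp : p ∣ k * m - 1) :
    (∃ α, poly a c k m 1 ∈ pointIdeal p α ^ 2) ↔
      ∃ α : AlgebraicClosure (ZMod p), α ^ (k * m - 1) = a ∧
        (frobQuot p a (padicValNat p (k * m - 1)) : ℤ) * α ^ k + (m * a * (c / p) : ℤ) = 0 := by
  set j := padicValNat p (k * m - 1) with hj
  have hm : m ≠ 0 := by rintro rfl; simp at hkm
  have hk : k ≠ 0 := by rintro rfl; simp at hkm
  have ha0 : (a : AlgebraicClosure (ZMod p)) ≠ 0 := by rwa [Ne, intCast_eq_zero_iff]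
  have key : ∀ α : AlgebraicClosure (ZMod p), α ^ (k * m - 1) = a →
      (poly a c k m 1 ∈ pointIdeal p α ^ 2 ↔
        (frobQuot p a j : ℤ) * α ^ k + (m * a * (c / p) : ℤ) = 0) := by
    intro α hα
    have hα0 : α ≠ 0 := by
      rintro rfl
      rw [zero_pow (by omega)] at hα
      exact ha0 hα.symm
    have hpow := pow_sub_C_mem_sq (by omega) hp hα
    rw [← hj] at hpow
    rw [mem_sq_iff_of_sub_mem (B := C (frobQuot p a j) * X + C (m : ℤ) * C (c / p) *
      X ^ (k * (m - 1)))]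
    · -- multiplying by `x ^ (k - 1)` turns `x ^ (k (m - 1))` into `x ^ (k m - 1) = a`
      have e1 : α ^ k = α * α ^ (k - 1) := by
        rw [← pow_succ', Nat.sub_add_cancel (by omega)]
      have e2 : (a : AlgebraicClosure (ZMod p)) = α ^ (k * (m - 1)) * α ^ (k - 1) := by
        rw [← hα, ← pow_add]
        congr 1
        obtain ⟨m, rfl⟩ := Nat.exists_eq_succ_of_ne_zero hm
        simp only [Nat.succ_eq_add_one, add_tsub_cancel_right, mul_add]
        omega
      simp only [map_add, map_mul, map_pow, evalAt_X, evalAt_C]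
      push_cast
      have e3 : (frobQuot p a j * α + m * (c / p : ℤ) * α ^ (k * (m - 1))) * α ^ (k - 1) =
          frobQuot p a j * α ^ k + m * a * (c / p : ℤ) := by
        rw [e1, e2]; ring
      rw [← e3, mul_eq_zero, or_iff_left (pow_ne_zero _ hα0)]
    · obtain ⟨e, he⟩ := powAddExpansion (X ^ k : ℤ[X]) (C c) m
      have hcs : e * C c ^ 2 ∈ pointIdeal p α ^ 2 :=
        Ideal.mul_mem_left _ _ (Ideal.pow_mem_pow (C_mem_pointIdeal.mpr hc) 2)
      have hx : (X ^ k : ℤ[X]) ^ m = X * X ^ (k * m - 1) := by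
        rw [← pow_mul, ← pow_succ', Nat.sub_add_cancel (by omega)]
      have : poly a c k m 1 - C (p : ℤ) * (C (frobQuot p a j) * X + C (m : ℤ) * C (c / p) *
          X ^ (k * (m - 1))) = X * (X ^ (k * m - 1) - C (a ^ p ^ j)) + e * C c ^ 2 := by
        rw [poly, he, hx]
        simp only [pow_mul]
        rw [show (C (m : ℤ) : ℤ[X]) = (m : ℤ[X]) by simp]
        linear_combination -X * C_mul_C_frobQuot (p := p) a j
          - (m : ℤ[X]) * (X ^ k) ^ (m - 1) * C_mul_C_ediv hc
      rw [this]
      exact add_mem (Ideal.mul_mem_left _ _ hpow) hcs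
  constructor
  · rintro ⟨α, h⟩
    obtain ⟨h0, h1⟩ := evalAt_eq_zero_of_mem_sq h
    have hα0 := ne_zero_of_derivative_eq_zero hkm hc ha h1
    have hα := root_pow_eq hc hkm hα0 h0
    exact ⟨α, hα, (key α hα).mp h⟩
  · rintro ⟨α, hα, h⟩
    exact ⟨α, (key α hα).mpr h⟩

/-- For `p ∣ c` and `m = 1`, at a root `α` of `x ^ (k - n) - a` one has `f ≡ p (a₁ x ^ n + c₂)` to
first order, where `p a₁ = a ^ (p ^ l) - a` and `p c₂ = c`; the hypothesis on `c / p` excludes the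
root `0`. -/
theorem exists_mem_sq_iff_of_dvd_of_not_dvd (hn : 2 ≤ n) (hkm : n < k) (hc : (p : ℤ) ∣ c)
    (ha : ¬ (p : ℤ) ∣ a) (hc2 : ¬ (p : ℤ) ∣ c / p) :
    (∃ α, poly a c k 1 n ∈ pointIdeal p α ^ 2) ↔
      ∃ α : AlgebraicClosure (ZMod p), α ^ (k - n) = a ∧
        (frobQuot p a (padicValNat p (k - n)) : ℤ) * α ^ n + (c / p : ℤ) = 0 := by
  have hkm' : n < k * 1 := by omega
  have ha0 : (a : AlgebraicClosure (ZMod p)) ≠ 0 := by rwa [Ne, intCast_eq_zero_iff]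
  have hc20 : ((c / p : ℤ) : AlgebraicClosure (ZMod p)) ≠ 0 := by rwa [Ne, intCast_eq_zero_iff]
  have key : ∀ α : AlgebraicClosure (ZMod p), α ^ (k - n) = a → p ∣ k - n →
      (poly a c k 1 n ∈ pointIdeal p α ^ 2 ↔
        (frobQuot p a (padicValNat p (k - n)) : ℤ) * α ^ n + (c / p : ℤ) = 0) := by
    intro α hα hp
    have hpow := pow_sub_C_mem_sq (by omega) hp hα
    set j := padicValNat p (k - n) with hj
    rw [mem_sq_iff_of_sub_mem (B := C (frobQuot p a j) * X ^ n + C (c / p))]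
    · simp only [map_add, map_mul, map_pow, evalAt_X, evalAt_C]
    · have hx : (X ^ k : ℤ[X]) = X ^ n * X ^ (k - n) := by
        rw [← pow_add, Nat.add_sub_cancel' hkm.le]
      have : poly a c k 1 n - C (p : ℤ) * (C (frobQuot p a j) * X ^ n + C (c / p)) =
          X ^ n * (X ^ (k - n) - C (a ^ p ^ j)) := by
        rw [poly, hx]
        linear_combination -X ^ n * C_mul_C_frobQuot (p := p) a j - C_mul_C_ediv hc
      rw [this]
      exact Ideal.mul_mem_left _ _ hpow
  constructor
  · rintro ⟨α, h⟩
    obtain ⟨h0, h1⟩ := evalAt_eq_zero_of_mem_sq h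
    have hα0 : α ≠ 0 := by
      rintro rfl
      rw [poly_mem_sq_zero_iff (by omega) hkm' hc (Or.inr hn), sq_dvd_iff hc] at h
      exact h ⟨rfl, hc2⟩
    have hα := root_pow_eq hc hkm' hα0 h0
    rw [mul_one] at hα
    have hp : p ∣ k - n := by
      have := euler_relation (by omega) one_pos (by omega) h0 h1
      rw [intCast_eq_zero_iff.mpr hc] at this
      simp [hα0] at this
      rw [← natCast_eq_zero_iff, Nat.cast_sub hkm.le]
      exact this
    exact ⟨α, hα, (key α hα hp).mp h⟩
  · rintro ⟨α, hα, h⟩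
    refine ⟨α, (key α hα ?_).mpr h⟩
    -- for `p ∤ k - n` the quotient `frobQuot p a 0` vanishes, which leaves `c / p = 0`
    by_contra hp
    rw [padicValNat.eq_zero_of_not_dvd hp] at h
    simp [frobQuot] at h
    exact hc20 h

end Cases

/-! ### Degree and roots of the polynomial -/

theorem degree_C_mul_X_pow_lt {a c : ℤ} {k m n : ℕ} (hkm : n < k * m) :
    (C a * X ^ n : ℤ[X]).degree < ((X ^ k + C c) ^ m : ℤ[X]).degree := by
  have hk : k ≠ 0 := by rintro rfl; simp at hkm
  refine (degree_C_mul_X_pow_le n a).trans_lt ?_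
  rw [degree_pow, degree_X_pow_add_C (Nat.pos_of_ne_zero hk), nsmul_eq_mul, mul_comm]
  exact_mod_cast hkm

theorem poly_monic {a c : ℤ} {k m n : ℕ} (hkm : n < k * m) : (poly a c k m n).Monic := by
  have hk : k ≠ 0 := by rintro rfl; simp at hkm
  exact ((monic_X_pow_add_C c hk).pow m).sub_of_left (degree_C_mul_X_pow_lt hkm)

theorem natDegree_poly {a c : ℤ} {k m n : ℕ} (hkm : n < k * m) :
    (poly a c k m n).natDegree = k * m := by
  rw [poly, natDegree_sub_eq_left_of_natDegree_lt, natDegree_pow, natDegree_X_pow_add_C, mul_comm]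
  refine (natDegree_C_mul_X_pow_le a n).trans_lt ?_
  rwa [natDegree_pow, natDegree_X_pow_add_C, mul_comm]

section Cases

variable {p : ℕ} [Fact p.Prime] {α : AlgebraicClosure (ZMod p)} {a c : ℤ} {k m n : ℕ}

theorem exists_root_poly (hkm : n < k * m) :
    ∃ α : AlgebraicClosure (ZMod p), evalAt p α (poly a c k m n) = 0 := by
  let ι := Int.castRingHom (ZMod p)
  have hdeg : ((poly a c k m n).map ι).degree ≠ 0 := by
    have hmon := poly_monic (a := a) (c := c) hkm
    rw [degree_eq_natDegree (hmon.map ι).ne_zero, hmon.natDegree_map, natDegree_poly hkm]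
    exact_mod_cast (by omega : k * m ≠ 0)
  obtain ⟨α, hα⟩ := IsAlgClosed.exists_aeval_eq_zero (AlgebraicClosure (ZMod p)) _ hdeg
  exact ⟨α, by rw [evalAt_eq_aeval_map, hα]⟩

theorem coprimeMod_iff {P Q : ℤ[X]} :
    CoprimeMod p P Q ↔
      ¬ ∃ α : AlgebraicClosure (ZMod p), evalAt p α Q = 0 ∧ evalAt p α P = 0 := by
  rw [CoprimeMod, isCoprime_iff_aeval_ne_zero_of_isAlgClosed _ (AlgebraicClosure (ZMod p))]
  simp only [← evalAt_eq_aeval_map]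
  push Not
  exact forall_congr' fun α => by tauto

theorem root_ne_zero (hc : ¬ (p : ℤ) ∣ c) (hkm : n < k * m) (hn : 1 ≤ n)
    (h0 : evalAt p α (poly a c k m n) = 0) : α ≠ 0 := by
  rintro rfl
  have hk : k ≠ 0 := by rintro rfl; simp at hkm
  rw [evalAt_poly, zero_pow hk, zero_pow (by omega : n ≠ 0), zero_add, mul_zero, sub_zero] at h0
  exact hc (intCast_eq_zero_iff.mp (eq_zero_of_pow_eq_zero h0))

/-! ### Primes dividing `a` but not `c` -/

/-- For `m ≥ 2` the power `(x ^ k + c) ^ m` vanishes to second order, which leaves `- a x ^ n`. -/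
theorem exists_mem_sq_iff_of_not_dvd_of_dvd (hn : 1 ≤ n) (hkm : n < k * m) (hm : 2 ≤ m)
    (hc : ¬ (p : ℤ) ∣ c) (ha : (p : ℤ) ∣ a) :
    (∃ α, poly a c k m n ∈ pointIdeal p α ^ 2) ↔ (p : ℤ) ^ 2 ∣ a := by
  have key : ∀ α, evalAt p α (poly a c k m n) = 0 →
      (poly a c k m n ∈ pointIdeal p α ^ 2 ↔ (p : ℤ) ^ 2 ∣ a) := by
    intro α h0
    have hα0 := root_ne_zero hc hkm hn h0
    rw [mem_sq_iff_of_sub_mem (B := -(C (a / p) * X ^ n)), sq_dvd_iff ha, map_neg, neg_eq_zero,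
      map_mul, evalAt_C, map_pow, evalAt_X, mul_eq_zero, or_iff_left (pow_ne_zero _ hα0),
      intCast_eq_zero_iff]
    have hroot : X ^ k + C c ∈ pointIdeal p α := by
      rw [evalAt_poly, intCast_eq_zero_iff.mpr ha, zero_mul, sub_zero] at h0
      rw [mem_pointIdeal, map_add, map_pow, evalAt_X, evalAt_C]
      exact eq_zero_of_pow_eq_zero h0
    have : poly a c k m n - C (p : ℤ) * -(C (a / p) * X ^ n) = (X ^ k + C c) ^ m := by
      rw [poly]
      linear_combination X ^ n * C_mul_C_ediv ha
    rw [this]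
    exact Ideal.pow_le_pow_right hm (Ideal.pow_mem_pow hroot m)
  constructor
  · rintro ⟨α, h⟩
    exact (key α (evalAt_eq_zero_of_mem_sq h).1).mp h
  · intro h
    obtain ⟨α, hα⟩ := exists_root_poly (p := p) (a := a) (c := c) hkm
    exact ⟨α, (key α hα).mpr h⟩

/-- For `m = 1` one has `f ≡ p (a₂ x ^ n + c₁)` to first order at the roots of `x ^ k + c`, where
`p a₂ = - a` and `p c₁ = (-c) ^ (p ^ l) + c`. -/
theorem exists_mem_sq_iff_of_not_dvd_of_dvd_one (hn : 1 ≤ n) (hkm : n < k)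
    (ha : (p : ℤ) ∣ a) (hp : p ∣ k) :
    (∃ α, poly a c k 1 n ∈ pointIdeal p α ^ 2) ↔
      ∃ α : AlgebraicClosure (ZMod p), α ^ k = (-c : ℤ) ∧
        (-(a / p) : ℤ) * α ^ n + (frobQuot p (-c) (padicValNat p k) : ℤ) = 0 := by
  have key : ∀ α : AlgebraicClosure (ZMod p), α ^ k = (-c : ℤ) →
      (poly a c k 1 n ∈ pointIdeal p α ^ 2 ↔
        (-(a / p) : ℤ) * α ^ n + (frobQuot p (-c) (padicValNat p k) : ℤ) = 0) := by
    intro α hα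
    have hpow := pow_sub_C_mem_sq (by omega) hp hα
    set l := padicValNat p k
    rw [mem_sq_iff_of_sub_mem (B := C (-(a / p)) * X ^ n + C (frobQuot p (-c) l))]
    · simp only [map_add, map_mul, map_pow, evalAt_X, evalAt_C]
    · have : poly a c k 1 n - C (p : ℤ) * (C (-(a / p)) * X ^ n + C (frobQuot p (-c) l)) =
          X ^ k - C ((-c) ^ p ^ l) := by
        have h := C_mul_C_frobQuot (p := p) (-c) l
        rw [C_neg (a := c)] at h
        rw [poly, C_neg]
        linear_combination X ^ n * C_mul_C_ediv ha - h
      rwa [this]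
  constructor
  · rintro ⟨α, h⟩
    have hα : α ^ k = (-c : ℤ) := by
      have h0 := (evalAt_eq_zero_of_mem_sq h).1
      rw [evalAt_poly, intCast_eq_zero_iff.mpr ha, pow_one] at h0
      push_cast
      linear_combination h0
    exact ⟨α, hα, (key α hα).mp h⟩
  · rintro ⟨α, hα, h⟩
    exact ⟨α, (key α hα).mpr h⟩

/-! ### Primes dividing neither `a` nor `c` -/

theorem C_dvd_add_pow_sub (c : ℤ) (j s : ℕ) :
    C (p : ℤ) ∣ (X ^ s + C c) ^ p ^ j - X ^ (s * p ^ j) - C c := by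
  rw [← map_eq_zero_iff_C_dvd]
  simp only [Polynomial.map_sub, Polynomial.map_pow, Polynomial.map_add, Polynomial.map_X,
    Polynomial.map_C]
  rw [add_pow_char_pow, ← C_pow, ZMod.pow_card_pow, ← pow_mul]
  ring

/-- The polynomial `t` measures the failure of the `p ^ j`-th power map to be additive on
`x ^ s + c`. -/
theorem C_mul_tPoly (c : ℤ) (j s : ℕ) :
    C (p : ℤ) * tPoly c p j s = (X ^ s + C c) ^ p ^ j - X ^ (s * p ^ j) - C c := by
  have h : (∑ i ∈ Finset.range (p ^ j), C (((p ^ j).choose i : ℤ) * c ^ (p ^ j - i)) *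
      X ^ (s * i) : ℤ[X]) = (X ^ s + C c) ^ p ^ j - X ^ (s * p ^ j) := by
    rw [add_pow, Finset.sum_range_succ, Nat.choose_self, Nat.sub_self, ← pow_mul]
    simp only [pow_zero, mul_one, Nat.cast_one, add_sub_cancel_right]
    refine Finset.sum_congr rfl fun i _ => ?_
    simp only [C_mul, C_pow, pow_mul]
    simp only [eq_intCast, map_natCast]
    ring
  rw [tPoly, h, C_mul_divInt (C_dvd_add_pow_sub c j s)]

/-- If `p ^ j` divides `k` and `n`, then `f ≡ g ^ (p ^ j)` modulo `p`, where
`g = (x ^ s' + c) ^ m - a x ^ s`. At a root of `g` the power `((x ^ s' + c) ^ m) ^ (p ^ j)` agrees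
with `(a x ^ s) ^ (p ^ j)` to first order, while
`x ^ k + c = (x ^ s' + c) ^ (p ^ j) - p t(x)`. -/
theorem exists_mem_sq_iff_of_dvd_k {j s s' : ℕ} (hj : j ≠ 0) :
    (∃ α, poly a c (p ^ j * s') m (p ^ j * s) ∈ pointIdeal p α ^ 2) ↔
      ¬ CoprimeMod p
        (divInt p (C (a ^ p ^ j - a) * X ^ (p ^ j * s) -
          C ((p : ℤ) * m) * tPoly c p j s' * (X ^ (p ^ j * s') + C c) ^ (m - 1)))
        (poly a c s' m s) := by
  set H := divInt p (C (a ^ p ^ j - a) * X ^ (p ^ j * s) -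
          C ((p : ℤ) * m) * tPoly c p j s' * (X ^ (p ^ j * s') + C c) ^ (m - 1)) with hHdef
  have hH : C (p : ℤ) * H = C (a ^ p ^ j - a) * X ^ (p ^ j * s) -
      C ((p : ℤ) * m) * tPoly c p j s' * (X ^ (p ^ j * s') + C c) ^ (m - 1) := by
    refine C_mul_divInt (dvd_sub ?_ ?_)
    · rw [← mul_frobQuot, C_mul, mul_assoc]
      exact dvd_mul_right _ _
    · rw [C_mul, mul_assoc, mul_assoc]
      exact dvd_mul_right _ _
  have ht := C_mul_tPoly (p := p) c j s'
  rw [coprimeMod_iff, not_not]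
  refine exists_congr fun α => ?_
  have hroot : evalAt p α (poly a c (p ^ j * s') m (p ^ j * s)) = 0 ↔
      evalAt p α (poly a c s' m s) = 0 := by
    have h : ((α ^ s' + c) ^ m - a * α ^ s) ^ p ^ j =
        (α ^ (p ^ j * s') + c) ^ m - a * α ^ (p ^ j * s) := by
      rw [sub_pow_char_pow, pow_right_comm, add_pow_char_pow, mul_pow, intCast_pow_prime_pow,
        intCast_pow_prime_pow, ← pow_mul, ← pow_mul, mul_comm s', mul_comm s]
    rw [evalAt_poly, evalAt_poly, ← h,
      pow_eq_zero_iff (pow_ne_zero j (Fact.out : p.Prime).ne_zero)]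
  have key : evalAt p α (poly a c s' m s) = 0 →
      poly a c (p ^ j * s') m (p ^ j * s) - C (p : ℤ) * H ∈ pointIdeal p α ^ 2 := by
    intro h0
    have hg : evalAt p α ((X ^ s' + C c) ^ m) = evalAt p α (C a * X ^ s) := by
      rw [poly, map_sub] at h0
      exact sub_eq_zero.mp h0
    have hpow := pow_sub_pow_mem_sq hg (dvd_pow_self p hj)
    set Q : ℤ[X] := X ^ (p ^ j * s') + C c with hQ
    obtain ⟨e, he⟩ := powAddExpansion Q (C (p : ℤ) * tPoly c p j s') m
    have hY : Q + C (p : ℤ) * tPoly c p j s' = (X ^ s' + C c) ^ p ^ j := by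
      rw [ht, hQ, mul_comm s']; ring
    rw [hY] at he
    have : poly a c (p ^ j * s') m (p ^ j * s) - C (p : ℤ) * H =
        (((X ^ s' + C c) ^ m) ^ p ^ j - (C a * X ^ s) ^ p ^ j) -
          e * tPoly c p j s' ^ 2 * C (p : ℤ) ^ 2 := by
      rw [hH, poly, ← hQ, pow_right_comm, he, mul_pow (C a), ← pow_mul, mul_comm s]
      simp only [C_mul, C_sub, C_pow, map_natCast]
      ring
    rw [this]
    exact sub_mem hpow (Ideal.mul_mem_left _ _
      (Ideal.pow_mem_pow (C_mem_pointIdeal.mpr dvd_rfl) 2))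
  constructor
  · intro h
    have h0 := hroot.mp (evalAt_eq_zero_of_mem_sq h).1
    exact ⟨h0, (mem_sq_iff_of_sub_mem (key h0)).mp h⟩
  · rintro ⟨h0, h⟩
    exact (mem_sq_iff_of_sub_mem (key h0)).mpr h

/-- If `p` divides `m` and `n`, then `(x ^ k + c) ^ m` agrees with `a ^ p x ^ n` to first order at
every root of `f`. -/
theorem exists_mem_sq_iff_of_dvd_m_of_dvd_n (hn : 1 ≤ n) (hkm : n < k * m)
    (hc : ¬ (p : ℤ) ∣ c) (hpm : p ∣ m) (hpn : p ∣ n) :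
    (∃ α, poly a c k m n ∈ pointIdeal p α ^ 2) ↔ (p : ℤ) ^ 2 ∣ a ^ p - a := by
  have hfrob : (p : ℤ) * frobQuot p a 1 = a ^ p - a := by rw [mul_frobQuot, pow_one]
  have key : ∀ α, evalAt p α (poly a c k m n) = 0 →
      (poly a c k m n ∈ pointIdeal p α ^ 2 ↔ (p : ℤ) ^ 2 ∣ a ^ p - a) := by
    intro α h0
    have hα0 := root_ne_zero hc hkm hn h0
    rw [mem_sq_iff_of_sub_mem (B := C (frobQuot p a 1) * X ^ n), ← hfrob, pow_two,
      mul_dvd_mul_iff_left prime_intCast.ne_zero, map_mul, evalAt_C, map_pow, evalAt_X,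
      mul_eq_zero, or_iff_left (pow_ne_zero _ hα0), intCast_eq_zero_iff]
    obtain ⟨m', rfl⟩ := hpm
    obtain ⟨n', rfl⟩ := hpn
    have hroot : evalAt p α ((X ^ k + C c) ^ m') = evalAt p α (C a * X ^ n') := by
      rw [← pow_expChar_pow_inj (j := 1), pow_one]
      simp only [map_mul, map_pow, map_add, evalAt_X, evalAt_C]
      have ha := intCast_pow_prime_pow (p := p) a 1
      rw [pow_one] at ha
      rw [evalAt_poly] at h0
      rw [mul_pow, ha, ← pow_mul, ← pow_mul, mul_comm m', mul_comm n']
      exact sub_eq_zero.mp h0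
    have : poly a c k (p * m') (p * n') - C (p : ℤ) * (C (frobQuot p a 1) * X ^ (p * n')) =
        ((X ^ k + C c) ^ m') ^ p - (C a * X ^ n') ^ p := by
      have hfrob' := C_mul_C_frobQuot (p := p) a 1
      rw [pow_one, C_pow] at hfrob'
      rw [poly, mul_pow, ← pow_mul, ← pow_mul, mul_comm m', mul_comm n']
      linear_combination -X ^ (p * n') * hfrob'
    rw [this]
    exact pow_sub_pow_mem_sq hroot dvd_rfl
  constructor
  · rintro ⟨α, h⟩
    exact (key α (evalAt_eq_zero_of_mem_sq h).1).mp h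
  · intro h
    obtain ⟨α, hα⟩ := exists_root_poly (p := p) (a := a) (c := c) hkm
    exact ⟨α, (key α hα).mpr h⟩

end Cases

/-! ### Primes not dividing `c a k m` -/

section Generic

variable {p : ℕ} [Fact p.Prime] {α : AlgebraicClosure (ZMod p)} {a c : ℤ} {k m n : ℕ}

theorem gcd_mul_kOne (k n : ℕ) : n.gcd k * kOne k n = k := Nat.mul_div_cancel' (Nat.gcd_dvd_right n k)

theorem gcd_mul_nOne (k n : ℕ) : n.gcd k * nOne k n = n := Nat.mul_div_cancel' (Nat.gcd_dvd_left n k)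

theorem nOne_lt (hkm : n < k * m) : nOne k n < kOne k n * m := by
  have hk := gcd_mul_kOne k n
  have hn := gcd_mul_nOne k n
  refine lt_of_mul_lt_mul_left (a := n.gcd k) ?_ (Nat.zero_le _)
  rwa [← mul_assoc, hk, hn]

theorem nOne_pos (hn : 1 ≤ n) : 0 < nOne k n :=
  Nat.div_gcd_pos_of_pos_left k hn

theorem kOne_pos (hk : 0 < k) : 0 < kOne k n :=
  Nat.div_gcd_pos_of_pos_right n hk

/-- At a common root `α` of `f` and `U = (k m - n) x ^ k - n c`, the membership of `f` in the square
of the ideal of `α` is decided by the integer `𝒞 - ℰ`: up to units, `f` is the difference of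
`((k m - n) (x ^ k + c)) ^ (k₁ m) = (U + k m c) ^ (k₁ m)` and of
`a ^ k₁ (k m - n) ^ (k₁ m - n₁) (U + n c) ^ n₁`; the constant term of its expansion in powers of `U`
is `c ^ n₁ (𝒞 - ℰ)`, and `t c` times its linear coefficient is the same integer. -/
theorem mem_sq_iff_sq_dvd (hn : 1 ≤ n) (hkm : n < k * m) (hp : ¬ (p : ℤ) ∣ c * a * k * m)
    (h0 : evalAt p α (poly a c k m n) = 0)
    (hU : evalAt p α (C ((k : ℤ) * m - n) * X ^ k - C (n * c)) = 0) :
    poly a c k m n ∈ pointIdeal p α ^ 2 ↔ (p : ℤ) ^ 2 ∣ calC c k m n - calE a k m n := by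
  have hk : 0 < k := Nat.pos_of_ne_zero (by rintro rfl; simp at hkm)
  simp only [prime_intCast.dvd_mul, not_or] at hp
  obtain ⟨⟨⟨hc, ha⟩, hpk⟩, hpm⟩ := hp
  have hα0 := root_ne_zero hc hkm hn h0
  have htk := gcd_mul_kOne k n
  have htn := gcd_mul_nOne k n
  have hlt := nOne_lt hkm
  have hn1 := nOne_pos (k := k) hn
  have hk1 := kOne_pos (n := n) hk
  rw [calC, calE]
  set t := n.gcd k
  set k₁ := kOne k n
  set n₁ := nOne k n
  set M := k₁ * m with hM
  set D : ℤ := (k : ℤ) * m - n with hD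
  set U : ℤ[X] := C D * X ^ k - C (n * c) with hUdef
  have htkZ : (t : ℤ) * k₁ = k := by exact_mod_cast htk
  have htnZ : (t : ℤ) * n₁ = n := by exact_mod_cast htn
  have hpt : ¬ (p : ℤ) ∣ t := fun h => hpk (htkZ ▸ h.mul_right _)
  have hpk1 : ¬ (p : ℤ) ∣ k₁ := fun h => hpk (htkZ ▸ h.mul_left _)
  have hpD : ¬ (p : ℤ) ∣ D := by
    intro h
    have hnc : (p : ℤ) ∣ n * c := by
      rw [← intCast_eq_zero_iff] at h ⊢
      simpa [hUdef, h] using hU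
    have hpn := (prime_intCast.dvd_mul.mp hnc).resolve_right hc
    have : (p : ℤ) ∣ k * m := by simpa [hD] using dvd_add h hpn
    exact (prime_intCast.dvd_mul.mp this).elim hpk hpm
  -- pass from `f` to a difference of `k₁`-th powers
  set A : ℤ[X] := (X ^ k + C c) ^ m
  set B : ℤ[X] := C a * X ^ n
  have hf : poly a c k m n = A - B := rfl
  have hAB : evalAt p α A = evalAt p α B := by
    rw [hf, map_sub] at h0
    exact sub_eq_zero.mp h0
  have hB0 : evalAt p α B ≠ 0 := by
    rw [map_mul, map_pow, evalAt_X, evalAt_C]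
    exact mul_ne_zero (mt intCast_eq_zero_iff.mp ha) (pow_ne_zero _ hα0)
  set S : ℤ[X] := C D ^ M * ∑ i ∈ Finset.range k₁, A ^ i * B ^ (k₁ - 1 - i) with hS
  have hS0 : evalAt p α S ≠ 0 := by
    rw [hS, map_mul, map_pow, evalAt_C, map_sum]
    simp only [map_mul, map_pow, hAB]
    rw [geom_sum₂_self]
    refine mul_ne_zero (pow_ne_zero _ (mt intCast_eq_zero_iff.mp hpD))
      (mul_ne_zero ?_ (pow_ne_zero _ hB0))
    exact_mod_cast mt intCast_eq_zero_iff.mp hpk1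
  have hSf : S * poly a c k m n = C D ^ M * (A ^ k₁ - B ^ k₁) := by
    rw [hS, hf, mul_assoc, geom_sum₂_mul]
  have hfS : poly a c k m n ∈ pointIdeal p α ^ 2 ↔
      C D ^ M * (A ^ k₁ - B ^ k₁) ∈ pointIdeal p α ^ 2 := by
    rw [← hSf]
    exact ⟨fun h => Ideal.mul_mem_left _ _ h, mem_sq_of_mul_mem_sq hS0⟩
  obtain ⟨N, hN⟩ : ∃ N, M = N + n₁ := ⟨M - n₁, by omega⟩
  have hMn : M - n₁ = N := by omega
  have hDA : C D ^ M * A ^ k₁ = (C ((k : ℤ) * m * c) + U) ^ M := by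
    have : (C ((k : ℤ) * m * c) + U : ℤ[X]) = C D * (X ^ k + C c) := by
      rw [hUdef, hD]
      simp only [C_mul, C_sub]
      ring
    rw [this, mul_pow, ← pow_mul, hM, mul_comm m]
  have hDB : C D ^ M * B ^ k₁ = C (a ^ k₁ * D ^ N) * (C ((n : ℤ) * c) + U) ^ n₁ := by
    have : (C ((n : ℤ) * c) + U : ℤ[X]) = C D * X ^ k := by rw [hUdef]; ring
    have hexp : n * k₁ = k * n₁ := by
      conv_lhs => rw [← htn]
      conv_rhs => rw [← htk]
      ring
    rw [this, mul_pow, mul_pow, ← pow_mul, ← pow_mul, hexp, hN, C_mul, C_pow, C_pow]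
    ring
  obtain ⟨e₁, he₁⟩ := powAddExpansion (C ((k : ℤ) * m * c)) U M
  obtain ⟨e₂, he₂⟩ := powAddExpansion (C ((n : ℤ) * c)) U n₁
  set Δ : ℤ := ((k : ℤ) * m) ^ M * c ^ (M - n₁) - a ^ k₁ * (n : ℤ) ^ n₁ * D ^ (M - n₁) with hΔ
  set β : ℤ := M * ((k : ℤ) * m * c) ^ (M - 1) - a ^ k₁ * D ^ N * (n₁ * (n * c) ^ (n₁ - 1)) with hβ
  have hconst : ((k : ℤ) * m * c) ^ M - a ^ k₁ * D ^ N * (n * c) ^ n₁ = c ^ n₁ * Δ := by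
    rw [hΔ, hMn, mul_pow, mul_pow _ c, hN, pow_add c]
    ring
  have hlin : (t : ℤ) * c * β = c ^ n₁ * Δ := by
    have h1 : ((k : ℤ) * m * c) ^ M = ((k : ℤ) * m * c) ^ (M - 1) * (k * m * c) :=
      (pow_sub_one_mul (by omega) _).symm
    have h2 : ((n : ℤ) * c) ^ n₁ = ((n : ℤ) * c) ^ (n₁ - 1) * (n * c) :=
      (pow_sub_one_mul (by omega) _).symm
    have hMZ : (M : ℤ) = k₁ * m := by rw [hM]; push_cast; rfl
    rw [← hconst, h1, h2, hβ, hMZ]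
    linear_combination ((k : ℤ) * m * c) ^ (M - 1) * m * c * htkZ
      - a ^ k₁ * D ^ N * ((n : ℤ) * c) ^ (n₁ - 1) * c * htnZ
  have hexpand : C D ^ M * (A ^ k₁ - B ^ k₁) =
      C (c ^ n₁ * Δ) + (C β * U + (e₁ - C (a ^ k₁ * D ^ N) * e₂) * (U * U)) := by
    rw [mul_sub, hDA, hDB, he₁, he₂, ← hconst, hβ]
    simp only [C_sub, C_mul, C_pow, map_natCast]
    ring
  have hval : evalAt p α (C D ^ M * (A ^ k₁ - B ^ k₁)) = 0 := by
    rw [← hSf, map_mul, h0, mul_zero]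
  have hUmem : U ∈ pointIdeal p α := mem_pointIdeal.mpr hU
  have hpcΔ : (p : ℤ) ∣ c ^ n₁ * Δ := by
    have hrest : C β * U + (e₁ - C (a ^ k₁ * D ^ N) * e₂) * (U * U) ∈ pointIdeal p α :=
      add_mem (Ideal.mul_mem_left _ _ hUmem)
        (Ideal.mul_mem_left _ _ (Ideal.mul_mem_left _ _ hUmem))
    rwa [← mem_pointIdeal, hexpand, Submodule.add_mem_iff_left _ hrest, C_mem_pointIdeal] at hval
  have hpβ : (p : ℤ) ∣ β := by
    rw [← hlin, prime_intCast.dvd_mul, prime_intCast.dvd_mul] at hpcΔ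
    exact hpcΔ.resolve_left (fun h => h.elim hpt hc)
  have hrest : C β * U + (e₁ - C (a ^ k₁ * D ^ N) * e₂) * (U * U) ∈ pointIdeal p α ^ 2 :=
    add_mem (mul_mem_sq (by rwa [evalAt_C, intCast_eq_zero_iff]) hU)
      (Ideal.mul_mem_left _ _ (mul_mem_sq hU hU))
  rw [hfS, hexpand, Submodule.add_mem_iff_left _ hrest, C_mem_sq_iff]
  have hcop : IsCoprime ((p : ℤ) ^ 2) (c ^ n₁) :=
    IsCoprime.pow (prime_intCast.coprime_iff_not_dvd.mpr hc)
  exact ⟨hcop.dvd_of_dvd_mul_left, fun h => h.mul_left _⟩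

/-- The double roots of `f` are those of the binomial system `(k m - n) x ^ k = n c`,
`a x ^ n = (x ^ k + c) ^ m`, whose solvability modulo `p` is the congruence `𝒞 ≡ ℰ`. -/
theorem exists_mem_sq_iff_of_not_dvd (hn : 1 ≤ n) (hkm : n < k * m)
    (hp : ¬ (p : ℤ) ∣ c * a * k * m) :
    (∃ α, poly a c k m n ∈ pointIdeal p α ^ 2) ↔
      (p : ℤ) ^ 2 ∣ calC c k m n - calE a k m n := by
  have hk : 0 < k := Nat.pos_of_ne_zero (by rintro rfl; simp at hkm)
  have hm : 0 < m := Nat.pos_of_ne_zero (by rintro rfl; simp at hkm)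
  have hp' := hp
  simp only [prime_intCast.dvd_mul, not_or] at hp'
  obtain ⟨⟨⟨hc, ha⟩, hpk⟩, hpm⟩ := hp'
  constructor
  · rintro ⟨α, h⟩
    obtain ⟨h0, h1⟩ := evalAt_eq_zero_of_mem_sq h
    have hα0 := root_ne_zero hc hkm hn h0
    refine (mem_sq_iff_sq_dvd hn hkm hp h0 ?_).mp h
    have heul := euler_relation hk hm hn h0 h1
    have hne : (α ^ k + c) ^ (m - 1) ≠ 0 := by
      intro hz
      have : (α ^ k + c) ^ m = 0 := by
        rw [← Nat.sub_add_cancel hm, pow_succ, hz, zero_mul]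
      rw [evalAt_poly, this, zero_sub, neg_eq_zero] at h0
      exact mul_ne_zero (mt intCast_eq_zero_iff.mp ha) (pow_ne_zero _ hα0) h0
    simpa using (mul_eq_zero.mp heul).resolve_left hne
  · intro h
    have hΔ : ((calC c k m n - calE a k m n : ℤ) : AlgebraicClosure (ZMod p)) = 0 :=
      intCast_eq_zero_iff.mpr ((dvd_pow_self _ two_ne_zero).trans h)
    rw [← intCast_eq_zero_iff] at hc ha hpk hpm
    have hlt := nOne_lt hkm
    have hn1 := nOne_pos (k := k) hn
    have hgk : k / k.gcd n = kOne k n := by rw [kOne, Nat.gcd_comm]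
    have hgn : n / k.gcd n = nOne k n := by rw [nOne, Nat.gcd_comm]
    rw [calC, calE] at hΔ
    push_cast at hΔ hpk hpm
    set k₁ := kOne k n
    set n₁ := nOne k n
    obtain ⟨N, hN⟩ : ∃ N, k₁ * m = N + n₁ := ⟨k₁ * m - n₁, by omega⟩
    rw [show k₁ * m - n₁ = N by omega] at hΔ
    set D : AlgebraicClosure (ZMod p) := k * m - n with hD
    have hC0 : ((k : AlgebraicClosure (ZMod p)) * m) ^ (k₁ * m) * c ^ N ≠ 0 :=
      mul_ne_zero (pow_ne_zero _ (mul_ne_zero hpk hpm)) (pow_ne_zero _ hc)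
    have hn0 : (n : AlgebraicClosure (ZMod p)) ≠ 0 := by
      intro hz
      rw [hz, zero_pow hn1.ne', mul_zero, zero_mul, sub_zero] at hΔ
      exact hC0 hΔ
    have hD0 : D ≠ 0 := by
      intro hz
      rw [hz, zero_pow (by omega : N ≠ 0), mul_zero, sub_zero] at hΔ
      exact hC0 hΔ
    -- `α` solves `α ^ k = n c / D` and `a α ^ n = (k m c / D) ^ m`
    obtain ⟨α, hα1, hα2⟩ := (exists_pow_eq_and_pow_eq_iff (n := n)
      (u := n * c / D) (v := (k * m * c / D) ^ m / a)
      (div_ne_zero (mul_ne_zero hn0 hc) hD0)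
      (div_ne_zero (pow_ne_zero _ (div_ne_zero (mul_ne_zero (mul_ne_zero hpk hpm) hc) hD0)) ha)
      hk).mpr (by
        rw [hgk, hgn, div_pow, div_pow, ← pow_mul, mul_comm m, div_pow, div_div,
          div_eq_div_iff (pow_ne_zero _ hD0)
            (mul_ne_zero (pow_ne_zero _ hD0) (pow_ne_zero _ ha)),
          mul_pow _ (c : AlgebraicClosure (ZMod p)), mul_pow _ (c : AlgebraicClosure (ZMod p)), hN,
          pow_add (c : AlgebraicClosure (ZMod p)), pow_add D, ← hN]
        linear_combination -(c : AlgebraicClosure (ZMod p)) ^ n₁ * D ^ n₁ * hΔ)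
    have hU : D * α ^ k - n * c = 0 := by
      rw [hα1]
      field_simp
      ring
    have hsum : α ^ k + c = k * m * c / D := by
      rw [eq_div_iff hD0]
      linear_combination hU + c * hD
    refine ⟨α, (mem_sq_iff_sq_dvd hn hkm hp ?_ ?_).mpr h⟩
    · rw [evalAt_poly, hsum, hα2]
      field_simp
      ring
    · simpa [hD] using hU

end Generic

/-! ### The conditions of the theorem -/

section LocalCriterion

variable {p : ℕ} [Fact p.Prime] {a c : ℤ} {k m n : ℕ}

theorem dvd_n_of_double_root (hn : 1 ≤ n) (hkm : n < k * m) (hc : ¬ (p : ℤ) ∣ c)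
    (ha : ¬ (p : ℤ) ∣ a) (hp : p ∣ k ∨ p ∣ m) {α : AlgebraicClosure (ZMod p)}
    (h0 : evalAt p α (poly a c k m n) = 0) (h1 : evalAt p α (derivative (poly a c k m n)) = 0) :
    p ∣ n := by
  have hα0 := root_ne_zero hc hkm hn h0
  rw [← intCast_eq_zero_iff] at ha
  rw [← natCast_eq_zero_iff, ← natCast_eq_zero_iff] at hp
  rw [evalAt_derivative_poly] at h1
  rcases hp with hp | hp <;> simpa [hp, ha, hα0, natCast_eq_zero_iff] using h1

theorem exists_mem_sq_iff_not_condII (hkm : 1 < k * m) (hc : (p : ℤ) ∣ c) (ha : ¬ (p : ℤ) ∣ a)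
    {α : AlgebraicClosure (ZMod p)} (h0 : evalAt p α (poly a c k m 1) = 0)
    (h1 : evalAt p α (derivative (poly a c k m 1)) = 0) :
    (∃ α, poly a c k m 1 ∈ pointIdeal p α ^ 2) ↔ ¬ CondII a c k m 1 p := by
  have hk : 0 < k := Nat.pos_of_ne_zero (by rintro rfl; simp at hkm)
  have hm : 0 < m := Nat.pos_of_ne_zero (by rintro rfl; simp at hkm)
  have hα0 := ne_zero_of_derivative_eq_zero hkm hc ha h1
  have hp : p ∣ k * m - 1 := by
    have := euler_relation hk hm one_pos h0 h1
    rw [intCast_eq_zero_iff.mpr hc] at this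
    simp [hα0] at this
    rw [← natCast_eq_zero_iff, Nat.cast_sub hkm.le]
    push_cast
    exact this
  have hpm : ¬ p ∣ m := fun h => (Fact.out : p.Prime).one_lt.ne' (Nat.dvd_one.mp
    ((Nat.dvd_sub_iff_right hkm.le (h.mul_left k)).mp hp))
  have hgcd : (k * m - 1).gcd k = 1 := by
    have h2 : (k * m - 1).gcd k ∣ k * m := (Nat.gcd_dvd_right _ _).mul_right m
    exact Nat.dvd_one.mp ((Nat.dvd_sub_iff_right hkm.le h2).mp (Nat.gcd_dvd_left _ _))
  have hj := one_le_padicValNat_of_dvd (by omega : k * m - 1 ≠ 0) hp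
  rw [exists_mem_sq_iff_of_dvd_of_not_dvd_one hkm hc ha hp, iff_not_comm,
    not_exists_root_iff' ha (by omega), hgcd]
  simp only [CondII, hc, ha, hj, prime_intCast.dvd_mul, Int.natCast_dvd_natCast, hpm, Nat.div_one,
    not_false_eq_true, true_and, false_or]

theorem exists_mem_sq_iff_not_condIII (hn : 2 ≤ n) (hkm : n < k * m) (hc : (p : ℤ) ∣ c)
    (ha : ¬ (p : ℤ) ∣ a) :
    (∃ α, poly a c k m n ∈ pointIdeal p α ^ 2) ↔ ¬ CondIII a c k m n p := by
  have hzero := poly_mem_sq_zero_iff (p := p) (a := a) (by omega) hkm hc (Or.inr hn)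
  by_cases hm : m = 1
  · subst hm
    have hkn : n < k := by omega
    by_cases hc2 : (p : ℤ) ∣ c / p
    · have : ¬ CondIII a c k 1 n p := by
        simp only [CondIII, hc2, prime_intCast.dvd_mul,
          (dvd_pow hc2 (by omega : n - 1 ≠ 0)), not_true, and_false, or_true, true_or, or_self]
        tauto
      simp only [this, not_false_eq_true, iff_true]
      exact ⟨0, hzero.mpr fun h => h.2 ((sq_dvd_iff hc).mpr hc2)⟩
    · have hc2' : ¬ (p : ℤ) ∣ (c / p) ^ (n - 1) := fun h => hc2 (prime_intCast.dvd_of_dvd_pow h)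
      have hg : (k - n).gcd n = n.gcd k := by
        rw [Nat.gcd_comm, Nat.gcd_sub_self_right hkn.le]
      have hg1 : (k - n) / n.gcd k = kOne k n - nOne k n := by
        refine Nat.div_eq_of_eq_mul_right (Nat.gcd_pos_of_pos_left _ (by omega)) ?_
        rw [Nat.mul_sub, gcd_mul_kOne, gcd_mul_nOne]
      rw [exists_mem_sq_iff_of_dvd_of_not_dvd hn hkn hc ha hc2, iff_not_comm,
        not_exists_root_iff ha (by omega), hg, hg1]
      simp only [CondIII, hc, ha, hn, hc2, hc2', prime_intCast.dvd_mul, nOne, or_false,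
        not_false_eq_true, true_and]
  · have : ¬ CondIII a c k m n p := fun h => hm h.2.2.2.1
    simp only [this, not_false_eq_true, iff_true]
    exact ⟨0, hzero.mpr fun h => hm h.1⟩

theorem exists_mem_sq_iff_not_condIV (hn : 1 ≤ n) (hkm : n < k * m) (hc : ¬ (p : ℤ) ∣ c)
    (ha : (p : ℤ) ∣ a) {α : AlgebraicClosure (ZMod p)}
    (h0 : evalAt p α (poly a c k m n) = 0)
    (h1 : evalAt p α (derivative (poly a c k m n)) = 0) :
    (∃ α, poly a c k m n ∈ pointIdeal p α ^ 2) ↔ ¬ CondIV a c k m n p := by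
  have hm : m ≠ 0 := by rintro rfl; simp at hkm
  by_cases hm1 : m = 1
  · subst hm1
    have hkn : n < k := by omega
    have hα0 := root_ne_zero hc hkm hn h0
    have hp : p ∣ k := by
      rw [evalAt_derivative_poly, intCast_eq_zero_iff.mpr ha] at h1
      simpa [hα0, natCast_eq_zero_iff] using h1
    have hl := one_le_padicValNat_of_dvd (by omega : k ≠ 0) hp
    have hg : k.gcd n = n.gcd k := Nat.gcd_comm k n
    rw [exists_mem_sq_iff_of_not_dvd_of_dvd_one hn hkn ha hp, iff_not_comm,
      not_exists_root_iff (by rwa [dvd_neg]) (by omega), hg]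
    simp only [CondIV, hc, ha, hl, kOne, nOne, not_false_eq_true, true_and]
    rw [mul_comm ((-c) ^ _)]
    simp
  · have hm2 : 2 ≤ m := by omega
    rw [exists_mem_sq_iff_of_not_dvd_of_dvd hn hkm hm2 hc ha]
    simp [CondIV, hc, ha, hm1, hm2]

theorem exists_mem_sq_iff_not_condV (hk : k ≠ 0) (hc : ¬ (p : ℤ) ∣ c) (ha : ¬ (p : ℤ) ∣ a)
    (hpk : p ∣ k) (hpn : p ∣ n) :
    (∃ α, poly a c k m n ∈ pointIdeal p α ^ 2) ↔ ¬ CondV a c k m n p := by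
  have hca : ¬ (p : ℤ) ∣ c * a := fun h => (prime_intCast.dvd_mul.mp h).elim hc ha
  have hne : ∀ j s s' : ℕ, k = p ^ j * s' → n = p ^ j * s → ¬ p ∣ s.gcd s' → j ≠ 0 := by
    rintro j s s' hk' hn' hs rfl
    rw [pow_zero, one_mul] at hk' hn'
    exact hs (hk' ▸ hn' ▸ Nat.dvd_gcd hpn hpk)
  constructor
  · rintro h ⟨-, -, j, s, s', hk', hn', hs, hcop⟩
    have hj := hne j s s' hk' hn' hs
    subst hk' hn'
    exact (exists_mem_sq_iff_of_dvd_k hj).mp h hcop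
  · intro h
    have hg0 : n.gcd k ≠ 0 := Nat.gcd_ne_zero_right hk
    obtain ⟨j, g, hg, hjg⟩ := Nat.exists_eq_pow_mul_and_not_dvd hg0 p (Fact.out : p.Prime).ne_one
    have hdvd : p ^ j ∣ n.gcd k := ⟨g, hjg⟩
    obtain ⟨s, hs⟩ := hdvd.trans (Nat.gcd_dvd_left n k)
    obtain ⟨s', hs'⟩ := hdvd.trans (Nat.gcd_dvd_right n k)
    have hgs : ¬ p ∣ s.gcd s' := by
      rw [hs, hs', Nat.gcd_mul_left] at hjg
      rwa [Nat.eq_of_mul_eq_mul_left (pow_pos (Fact.out : p.Prime).pos j) hjg]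
    have hj := hne j s s' hs' hs hgs
    have hiff := exists_mem_sq_iff_of_dvd_k (p := p) (a := a) (c := c) (m := m) (s := s)
      (s' := s') hj
    rw [← hs, ← hs'] at hiff
    exact hiff.mpr fun hcop => h ⟨hca, hpk, j, s, s', hs', hs, hgs, hcop⟩

/-- If `f` has a double root modulo `p`, the conditions say that `f` lies in the square of the
ideal of no point. -/
theorem exists_mem_sq_iff_not_cond (hn : 1 ≤ n) (hkm : n < k * m)
    {α : AlgebraicClosure (ZMod p)} (h0 : evalAt p α (poly a c k m n) = 0)
    (h1 : evalAt p α (derivative (poly a c k m n)) = 0) :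
    (∃ α, poly a c k m n ∈ pointIdeal p α ^ 2) ↔ ¬ Cond a c k m n p := by
  have hk : k ≠ 0 := by rintro rfl; simp at hkm
  have hmul : ∀ x y : ℤ, (p : ℤ) ∣ x * y ↔ (p : ℤ) ∣ x ∨ (p : ℤ) ∣ y := fun x y =>
    prime_intCast.dvd_mul
  by_cases hc : (p : ℤ) ∣ c <;> by_cases ha : (p : ℤ) ∣ a
  · rw [exists_mem_sq_iff_of_dvd_of_dvd hn hkm hc ha, not_iff_not]
    simp [Cond, CondI, CondII, CondIII, CondIV, CondV, CondVI, CondVII, hmul, hc, ha]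
  · rcases Nat.eq_or_lt_of_le hn with rfl | hn2
    · rw [exists_mem_sq_iff_not_condII hkm hc ha h0 h1, not_iff_not]
      simp [Cond, CondI, CondIII, CondIV, CondV, CondVI, CondVII, hmul, hc, ha]
    · rw [exists_mem_sq_iff_not_condIII hn2 hkm hc ha, not_iff_not]
      simp [Cond, CondI, CondII, CondIV, CondV, CondVI, CondVII, hmul, hc, ha, hn2.ne']
  · rw [exists_mem_sq_iff_not_condIV hn hkm hc ha h0 h1, not_iff_not]
    simp [Cond, CondI, CondII, CondIII, CondV, CondVI, CondVII, hmul, hc, ha]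
  · by_cases hpk : p ∣ k
    · have hpn := dvd_n_of_double_root hn hkm hc ha (Or.inl hpk) h0 h1
      rw [exists_mem_sq_iff_not_condV hk hc ha hpk hpn, not_iff_not]
      simp [Cond, CondI, CondII, CondIII, CondIV, CondVI, CondVII, hmul, hc, ha, hpk,
        Int.natCast_dvd_natCast]
    · by_cases hpm : p ∣ m
      · have hpn := dvd_n_of_double_root hn hkm hc ha (Or.inr hpm) h0 h1
        rw [exists_mem_sq_iff_of_dvd_m_of_dvd_n hn hkm hc hpm hpn]
        simp [Cond, CondI, CondII, CondIII, CondIV, CondV, CondVI, CondVII, hmul, hc, ha, hpk, hpm,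
          hpn, Int.natCast_dvd_natCast]
      · have hp : ¬ (p : ℤ) ∣ c * a * k * m := by
          simp [hmul, hc, ha, hpk, hpm, Int.natCast_dvd_natCast]
        rw [exists_mem_sq_iff_of_not_dvd hn hkm hp]
        simp [Cond, CondI, CondII, CondIII, CondIV, CondV, CondVI, CondVII, hmul, hc, ha, hpk, hpm,
          Int.natCast_dvd_natCast]

end LocalCriterion

end PolyFamily

open PolyFamily in
theorem theorem2p2 {K : Type*} [Field K] [NumberField K] (θ : NumberField.RingOfIntegers K)
    (hK : IntermediateField.adjoin ℚ {(θ : K)} = ⊤)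
    (a c : ℤ) (k m n : ℕ) (hn : 1 ≤ n) (hkm : n < k * m)
    (hf : minpoly ℚ (θ : K) = (PolyFamily.poly a c k m n).map (Int.castRingHom ℚ)) :
    (∀ p : ℕ, p.Prime → (p : ℤ) ∣ (PolyFamily.poly a c k m n).discr →
      (¬ p ∣ (Subalgebra.toSubmodule (Algebra.adjoin ℤ {θ})).toAddSubgroup.index ↔
        PolyFamily.Cond a c k m n p)) ∧
    (Algebra.adjoin ℤ {θ} = ⊤ ↔
      ∀ p : ℕ, p.Prime → (p : ℤ) ∣ (PolyFamily.poly a c k m n).discr →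
        PolyFamily.Cond a c k m n p) := by
  have hmin : minpoly ℤ θ = poly a c k m n := by
    have hint : IsIntegral ℤ θ := Algebra.IsIntegral.isIntegral θ
    have h := minpoly.isIntegrallyClosed_eq_field_fractions ℚ K hint
    exact Polynomial.map_injective (Int.castRingHom ℚ) Int.cast_injective (h.symm.trans hf)
  have hdeg : 0 < (poly a c k m n).natDegree := by
    rw [natDegree_poly hkm]
    omega
  have hmain : ∀ p : ℕ, p.Prime → (p : ℤ) ∣ (poly a c k m n).discr →
      (¬ p ∣ (Subalgebra.toSubmodule (Algebra.adjoin ℤ {θ})).toAddSubgroup.index ↔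
        Cond a c k m n p) := by
    intro p hp hd
    have : Fact p.Prime := ⟨hp⟩
    obtain ⟨α, h0, h1⟩ := (dvd_discr_iff (poly_monic hkm) hdeg).mp hd
    rw [dvd_index_iff hK, hmin, exists_mem_sq_iff_not_cond hn hkm h0 h1, not_not]
  refine ⟨hmain, ?_⟩
  have htop : Algebra.adjoin ℤ {θ} = ⊤ ↔
      (Subalgebra.toSubmodule (Algebra.adjoin ℤ {θ})).toAddSubgroup.index = 1 := by
    rw [AddSubgroup.index_eq_one, ← Submodule.top_toAddSubgroup (R := ℤ),
      Submodule.toAddSubgroup_inj, Algebra.toSubmodule_eq_top]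
  rw [htop]
  constructor
  · intro h p hp hd
    rw [← hmain p hp hd, h]
    exact hp.not_dvd_one
  · intro h
    by_contra hne
    obtain ⟨p, hp, hpdvd⟩ := Nat.exists_prime_and_dvd hne
    have : Fact p.Prime := ⟨hp⟩
    -- a prime divisor of the index divides the discriminant
    obtain ⟨α, hα⟩ := (dvd_index_iff hK).mp hpdvd
    rw [hmin] at hα
    have hd := (dvd_discr_iff (poly_monic hkm) hdeg).mpr ⟨α, evalAt_eq_zero_of_mem_sq hα⟩
    exact (hmain p hp hd).mpr (h p hp hd) hpdvd
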